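/- Let $n\ge 0$, let $\lambda_0,\dots,\lambda_n\in\mathbb C$ with $\sum_i\lambda_i=0$, and let $\hbar\in\mathbb C\setminus\{0\}$ (for example $\hbar>0$). **Quantum Toda operators.** For $t=(t_0,\dots,t_n)\in\mathbb C^{n+1}$ put $q_k=e^{t_k-t_{k-1}}$, $1\le k\le n$. Let $A$ be the tridiagonal $(n+1)\times(n+1)$ matrix with diagonal $p_0,\dots,p_n$, superdiagonal $q_1,\dots,q_n$ and all subdiagonal entries $-1$, and write $\det(A+xI)=x^{n+1}+\sum_{i=1}^{n+1}D_i(p,q)\,x^{n+1-i}$. The operator $D_i$ is obtained from $D_i(p,q)$ by substituting $p_j=\hbar\,\partial/\partial t_j$ (no ordering question arises, since $q_k$ is never multiplied by $p_{k-1}$ or $p_k$). Let $\sigma_i$ be defined by $x^{n+1}+\sigma_1x^n+\dots+\sigma_{n+1}=\prod_{i=0}^n(x-\lambda_i)$. **The phase function.** Consider variables $T_{ij}$, $i,j\ge 0$, $i+j\le n$, with $T_{0j}=t_j$, and for $i\ge1$ put $u_{ij}=e^{T_{i,j}-T_{i-1,j}}$ and $v_{ij}=e^{T_{i-1,j+1}-T_{i,j}}$.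 For fixed $t$ these parametrize the torus $Y_q\cong(\mathbb C^\times)^{n(n+1)/2}$ of all $(u,v)$ with $v_{i,j}u_{i,j+1}=u_{i+1,j}v_{i+1,j}$ and $u_{1,k-1}v_{1,k-1}=q_k$, and the $T_{ij}$ with $i\ge1$ are coordinates on its universal covering $\mathbb C^{n(n+1)/2}$. On this covering let $$f_q=\sum_{i\ge1,\,j}(u_{ij}+v_{ij})+\sum_{i\ge1,\,j}\bigl(\lambda_{u_{ij}}\ln u_{ij}+\lambda_{v_{ij}}\ln v_{ij}\bigr),\qquad \omega_q=\bigwedge_{i\ge1,\,j}dT_{ij},$$ where $\ln u_{ij}=T_{i,j}-T_{i-1,j}$, $\ln v_{ij}=T_{i-1,j+1}-T_{i,j}$, and the weights are $\lambda_{u_{i,0}}=\lambda_{i-1}+\frac12\sum_{j<i-1}\lambda_j=-\lambda_{v_{i,n-i}}$, and $\lambda_{u_{ij}}=\frac12\lambda_{i-1}$ for $j>0$, $\lambda_{v_{ij}}=-\frac12\lambda_{i-1}$ for $i+j<n$. **The cycles.** Put $N=n(n+1)/2$. A descending Morse cycle of $\operatorname{Re}f_q$ at a critical point $c$ is an oriented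 cell, given by a smooth injective immersion $\varphi:\mathbb R^N\to\mathbb C^N$, whose image is the set of end points $\gamma(0)$ of trajectories $\gamma:(-\infty,0]\to\mathbb C^N$ of $-\operatorname{grad}\operatorname{Re}f_q$ with $\gamma(s)\to c$ as $s\to-\infty$, for some smooth Riemannian metric, and such that $\operatorname{Re}f_q(\varphi(x))\to-\infty$ as $x\to\infty$. A covariantly constant family over an open set $U\subset\mathbb C^{n+1}$ of parameters $t$ is a family of cells $\Gamma_t$ parametrized by $\Phi_t:\mathbb R^N\to\mathbb C^N$ such that $(t,x)\mapsto\Phi_t(x)$ is smooth on $U\times\mathbb R^N$; $\operatorname{Re}f_q(\Phi_t(x))\to-\infty$ as $x\to\infty$, locally uniformly in $t$; and, near each $t_1\in U$ and for every $k\in\mathbb N$, the function $$\bigl|e^{f_q(\Phi_t(x))/\hbar}\bigr|\,\Bigl(1+\sum_{i\ge1,\,j}(|u_{ij}|+|v_{ij}|)\Bigr)^k\bigl(1+\|D_{(t,x)}\Phi\|\bigr)^N$$ is bounded, for all $t$ near $t_1$, by an integrable function of $x$ independent of $t$ (here $u_{ij},v_{ij}$ are taken at $\Phi_t(x)$). **Theorem.**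 Let $U\subset\mathbb C^{n+1}$ be open, $t^0\in U$, and let $(\Gamma_t)_{t\in U}$ be a covariantly constant family such that $\Gamma_{t^0}$ is a descending Morse cycle of $\operatorname{Re}f_{q(t^0)}$ at a nondegenerate critical point of $f_{q(t^0)}$. Then $$\mathcal I(t)=\int_{\Gamma_t}e^{f_q/\hbar}\,\omega_q$$ converges absolutely for every $t\in U$, is holomorphic on $U$, and satisfies $$D_i\,\mathcal I=\sigma_i\,\mathcal I\qquad\text{on }U,\quad i=1,\dots,n+1.$$ -/

import Mathlib

open scoped Manifold ContDiff Topology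

noncomputable section

namespace TodaMirror

/-! ### Quantum Toda operators -/

/-- `q_{k+1} = exp (t_{k+1} - t_k)`, for `k = 0, …, n-1`. -/
def qVar {n : ℕ} (t : Fin (n + 1) → ℂ) (k : Fin n) : ℂ :=
  Complex.exp (t k.succ - t k.castSucc)

/-- The tridiagonal Toda matrix `A` over the polynomial ring in `p_0, …, p_n` (the variables
`Sum.inl i`) and `q_1, …, q_n` (`q_{k+1}` is the variable `Sum.inr k`): the diagonal is
`p_0, …, p_n`, the superdiagonal `q_1, …, q_n`, the subdiagonal is constantly `-1`. -/
def todaMatrix (n : ℕ) :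
    Matrix (Fin (n + 1)) (Fin (n + 1)) (MvPolynomial (Fin (n + 1) ⊕ Fin n) ℂ) :=
  Matrix.of fun i j =>
    if i = j then MvPolynomial.X (Sum.inl i)
    else if h : (i : ℕ) + 1 = (j : ℕ) then MvPolynomial.X (Sum.inr ⟨i, by omega⟩)
    else if (j : ℕ) + 1 = (i : ℕ) then -1
    else 0

/-- `D_i(p, q)`: the coefficient of `x ^ (n + 1 - i)` in `det (A + x I)`. -/
def todaPoly (n i : ℕ) : MvPolynomial (Fin (n + 1) ⊕ Fin n) ℂ :=
  ((todaMatrix n).map Polynomial.C +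
    Matrix.scalar (Fin (n + 1)) (Polynomial.X : Polynomial _)).det.coeff (n + 1 - i)

/-- The operator `ħ ∂/∂t_j` on functions of `(t_0, …, t_n)`. -/
def hPartial {n : ℕ} (hbar : ℂ) (j : Fin (n + 1)) (F : (Fin (n + 1) → ℂ) → ℂ) :
    (Fin (n + 1) → ℂ) → ℂ :=
  fun t => hbar * fderiv ℂ F t (Pi.single j 1)

/-- The operator `(ħ ∂/∂t_0) ^ a_0 ⋯ (ħ ∂/∂t_n) ^ a_n`. -/
def hPartials {n : ℕ} (hbar : ℂ) (a : Fin (n + 1) → ℕ) (F : (Fin (n + 1) → ℂ) → ℂ) :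
    (Fin (n + 1) → ℂ) → ℂ :=
  (List.finRange (n + 1)).foldr (fun j G => (hPartial hbar j)^[a j] G) F

/-- Substitution of `p_j = ħ ∂/∂t_j` and `q_k = exp (t_k - t_{k-1})` in a polynomial. The
coefficients are written to the left of the derivatives; for the polynomials `todaPoly n i` no
ordering question arises, because in each of their monomials the factor `q_k` only occurs together
with `p_j` for `j ≠ k - 1, k`. -/
def quantize {n : ℕ} (hbar : ℂ) (P : MvPolynomial (Fin (n + 1) ⊕ Fin n) ℂ)
    (F : (Fin (n + 1) → ℂ) → ℂ) : (Fin (n + 1) → ℂ) → ℂ :=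
  fun t => ∑ m ∈ P.support,
    P.coeff m * (∏ k : Fin n, qVar t k ^ m (Sum.inr k)) *
      hPartials hbar (fun j => m (Sum.inl j)) F t

/-- The quantum Toda operator `D_i`. -/
def quantumToda {n : ℕ} (hbar : ℂ) (i : ℕ) (F : (Fin (n + 1) → ℂ) → ℂ) :
    (Fin (n + 1) → ℂ) → ℂ :=
  quantize hbar (todaPoly n i) F

/-- `σ_i`, defined by `x ^ (n+1) + σ_1 x ^ n + ⋯ + σ_{n+1} = ∏ (x - lam_i)`. -/
def sigma {n : ℕ} (lam : Fin (n + 1) → ℂ) (i : ℕ) : ℂ :=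
  (∏ j : Fin (n + 1), (Polynomial.X - Polynomial.C (lam j))).coeff (n + 1 - i)

/-! ### The triangular graph, the torus and the phase function -/

/-- The vertices `(i, j)` of the triangular graph that are not on the main diagonal `i = 0`;
`i` is the number of the diagonal and `j` the horizontal coordinate. The same set indexes the
vertical edges `u_{ij}`, with head `(i, j)` and tail `(i-1, j)`, and the horizontal edges
`v_{ij}`, with tail `(i, j)` and head `(i-1, j+1)`. -/
abbrev Vtx (n : ℕ) : Type :=
  {p : Fin (n + 1) × Fin (n + 1) // 1 ≤ (p.1 : ℕ) ∧ (p.1 : ℕ) + (p.2 : ℕ) ≤ n}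

/-- The vertex `(i, j)`. -/
def vtx {n : ℕ} (i j : ℕ) (h : 1 ≤ i ∧ i + j ≤ n) : Vtx n :=
  ⟨(⟨i, by omega⟩, ⟨j, by omega⟩), h⟩

/-- All vertex variables `T_{ij}`, where `T_{0j} = t_j` and the `T_{ij}` with `i > 0` are the
coordinates of `y` (the value is `0` outside the graph). -/
def volt {n : ℕ} (t : Fin (n + 1) → ℂ) (y : Vtx n → ℂ) (i j : ℕ) : ℂ :=
  if h : 1 ≤ i ∧ i + j ≤ n then y (vtx i j h)
  else if h : i = 0 ∧ j < n + 1 then t ⟨j, h.2⟩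
  else 0

/-- `ln u_{ij} = T_{i,j} - T_{i-1,j}`. -/
def logU {n : ℕ} (t : Fin (n + 1) → ℂ) (y : Vtx n → ℂ) (e : Vtx n) : ℂ :=
  volt t y e.1.1 e.1.2 - volt t y (e.1.1 - 1) e.1.2

/-- `ln v_{ij} = T_{i-1,j+1} - T_{i,j}`. -/
def logV {n : ℕ} (t : Fin (n + 1) → ℂ) (y : Vtx n → ℂ) (e : Vtx n) : ℂ :=
  volt t y (e.1.1 - 1) (e.1.2 + 1) - volt t y e.1.1 e.1.2

/-- The edge variable `u_{ij}`. -/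
def edgeU {n : ℕ} (t : Fin (n + 1) → ℂ) (y : Vtx n → ℂ) (e : Vtx n) : ℂ :=
  Complex.exp (logU t y e)

/-- The edge variable `v_{ij}`. -/
def edgeV {n : ℕ} (t : Fin (n + 1) → ℂ) (y : Vtx n → ℂ) (e : Vtx n) : ℂ :=
  Complex.exp (logV t y e)

/-- The torus `Y_q`, `q = q(t)`: all `(u, v)` that satisfy the box and the roof equations. -/
def mirrorTorus {n : ℕ} (t : Fin (n + 1) → ℂ) : Set ((Vtx n → ℂ) × (Vtx n → ℂ)) :=
  {w | (∀ (i j : ℕ) (h : 1 ≤ i ∧ i + j + 1 ≤ n),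
          w.2 (vtx i j (by omega)) * w.1 (vtx i (j + 1) (by omega)) =
            w.1 (vtx (i + 1) j (by omega)) * w.2 (vtx (i + 1) j (by omega))) ∧
       (∀ k : Fin n,
          w.1 (vtx 1 k (by omega)) * w.2 (vtx 1 k (by omega)) = qVar t k)}

/-- The weight `λ_{i-1} + ½ ∑_{j < i-1} λ_j` of the outer edge `u_{i,0}`. -/
def outerWeight {n : ℕ} (lam : Fin (n + 1) → ℂ) (e : Vtx n) : ℂ :=
  lam ⟨(e.1.1 : ℕ) - 1, by omega⟩ +
    1 / 2 * ∑ j : Fin (n + 1), if (j : ℕ) + 1 < (e.1.1 : ℕ) then lam j else 0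

/-- The weight of `u_{ij}`. -/
def weightU {n : ℕ} (lam : Fin (n + 1) → ℂ) (e : Vtx n) : ℂ :=
  if (e.1.2 : ℕ) = 0 then outerWeight lam e
  else 1 / 2 * lam ⟨(e.1.1 : ℕ) - 1, by omega⟩

/-- The weight of `v_{ij}`. -/
def weightV {n : ℕ} (lam : Fin (n + 1) → ℂ) (e : Vtx n) : ℂ :=
  if (e.1.1 : ℕ) + (e.1.2 : ℕ) = n then -outerWeight lam e
  else -(1 / 2) * lam ⟨(e.1.1 : ℕ) - 1, by omega⟩

/-- The phase function `f_q`. Its logarithmic terms are multivalued on the torus `Y_q`, so it is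
written on the universal covering `ℂ ^ (n(n+1)/2) → Y_q`, in the coordinates
`T_{ij}`, `i > 0` (see `range_edges`). -/
def phase {n : ℕ} (lam t : Fin (n + 1) → ℂ) (y : Vtx n → ℂ) : ℂ :=
  ∑ e, (edgeU t y e + edgeV t y e) +
    ∑ e, (weightU lam e * logU t y e + weightV lam e * logV t y e)

/-- `1` plus the sum of the absolute values of all edge variables. -/
def edgeSize {n : ℕ} (t : Fin (n + 1) → ℂ) (y : Vtx n → ℂ) : ℝ :=
  1 + ∑ e, (‖edgeU t y e‖ + ‖edgeV t y e‖)

/-- The edge variables define a map from the space of the `T_{ij}`, `i > 0`, onto `Y_q`. -/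
theorem range_edges {n : ℕ} (t : Fin (n + 1) → ℂ) :
    Set.range (fun y : Vtx n → ℂ => (edgeU t y, edgeV t y)) = mirrorTorus t := by
  have v0 : ∀ (y : Vtx n → ℂ) (k : ℕ) (h : k < n + 1), volt t y 0 k = t ⟨k, h⟩ := by
    intro y k h
    simp [volt, h]
  have v1 : ∀ (y : Vtx n → ℂ) (i j : ℕ) (h : 1 ≤ i ∧ i + j ≤ n),
      volt t y i j = y (vtx i j h) := by
    intro y i j h
    simp [volt, h]
  apply Set.Subset.antisymm
  · rintro _ ⟨y, rfl⟩
    refine ⟨fun i j h => ?_, fun k => ?_⟩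
    · simp only [edgeU, edgeV, ← Complex.exp_add]
      congr 1
      simp only [logU, logV, vtx, Nat.add_sub_cancel]
      ring
    · simp only [edgeU, edgeV, ← Complex.exp_add, qVar]
      congr 1
      have e1 := v0 y k (by omega)
      have e2 := v0 y (k + 1) (by omega)
      simp only [logU, logV, vtx, Nat.sub_self]
      rw [e1, e2]
      simp only [Fin.succ, Fin.castSucc, Fin.castAdd, Fin.castLE]
      ring
  · rintro ⟨u, v⟩ ⟨hbox, hroof⟩
    have hne : ∀ (i j : ℕ) (h : 1 ≤ i + 1 ∧ i + 1 + j ≤ n),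
        u (vtx (i + 1) j h) ≠ 0 ∧ v (vtx (i + 1) j h) ≠ 0 := by
      intro i
      induction i with
      | zero =>
        intro j h
        have := hroof ⟨j, by omega⟩
        have h2 : u (vtx 1 j (by omega)) * v (vtx 1 j (by omega)) ≠ 0 := by
          rw [this]
          exact Complex.exp_ne_zero _
        exact mul_ne_zero_iff.1 h2
      | succ i ih =>
        intro j h
        have h1 := hbox (i + 1) j (by omega)
        apply mul_ne_zero_iff.1
        rw [← h1]
        exact mul_ne_zero (ih j (by omega)).2 (ih (j + 1) (by omega)).1
    let T : ℕ → ℕ → ℂ := fun i => Nat.rec (fun j => if h : j < n + 1 then t ⟨j, h⟩ else 0)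
      (fun i r j => r j + if h : 1 ≤ i + 1 ∧ i + 1 + j ≤ n then
        Complex.log (u (vtx (i + 1) j h)) else 0) i
    have T0 : ∀ (j : ℕ) (h : j < n + 1), T 0 j = t ⟨j, h⟩ := by
      intro j h
      exact dif_pos h
    have T1 : ∀ (i j : ℕ) (h : 1 ≤ i + 1 ∧ i + 1 + j ≤ n),
        T (i + 1) j = T i j + Complex.log (u (vtx (i + 1) j h)) := by
      intro i j h
      simp only [T]
      rw [dif_pos h]
    have hV : ∀ (i j : ℕ), i + j ≤ n →
        volt t (fun e : Vtx n => T e.1.1 e.1.2) i j = T i j := by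
      intro i j h
      rcases Nat.eq_zero_or_pos i with rfl | hi
      · rw [v0 _ j (by omega), T0 j (by omega)]
      · rw [v1 _ i j ⟨hi, h⟩]
        rfl
    have hu : ∀ (i j : ℕ) (h : 1 ≤ i + 1 ∧ i + 1 + j ≤ n),
        Complex.exp (T (i + 1) j - T i j) = u (vtx (i + 1) j h) := by
      intro i j h
      rw [T1 i j h, add_sub_cancel_left, Complex.exp_log (hne i j h).1]
    have hv : ∀ (i j : ℕ) (h : 1 ≤ i + 1 ∧ i + 1 + j ≤ n),
        Complex.exp (T i (j + 1) - T (i + 1) j) = v (vtx (i + 1) j h) := by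
      intro i
      induction i with
      | zero =>
        intro j h
        have h1 := hroof ⟨j, by omega⟩
        apply mul_left_cancel₀ (hne 0 j h).1
        refine Eq.trans ?_ h1.symm
        rw [← hu 0 j h, ← Complex.exp_add, T0 j (by omega), T0 (j + 1) (by omega), qVar]
        congr 1
        simp only [Fin.succ, Fin.castSucc, Fin.castAdd, Fin.castLE]
        ring
      | succ i ih =>
        intro j h
        have h1 := hbox (i + 1) j (by omega)
        apply mul_left_cancel₀ (hne (i + 1) j h).1
        refine Eq.trans ?_ h1
        change _ = v (vtx (i + 1) j _) * u (vtx (i + 1) (j + 1) _)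
        rw [← hu (i + 1) j h, ← ih j (by omega), ← hu i (j + 1) (by omega), ← Complex.exp_add,
          ← Complex.exp_add]
        congr 1
        ring
    refine ⟨fun e => T e.1.1 e.1.2, ?_⟩
    ext ⟨⟨⟨i, hi⟩, ⟨j, hj⟩⟩, h⟩
    · obtain ⟨i, rfl⟩ : ∃ k, i = k + 1 := ⟨i - 1, by simp at h; omega⟩
      simp only at h
      simp only [edgeU, logU, Nat.add_sub_cancel]
      rw [hV _ _ h.2, hV _ _ (by omega)]
      exact hu i j h
    · obtain ⟨i, rfl⟩ : ∃ k, i = k + 1 := ⟨i - 1, by simp at h; omega⟩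
      simp only at h
      simp only [edgeV, logV, Nat.add_sub_cancel]
      rw [hV _ _ h.2, hV _ _ (by omega)]
      exact hv i j h

/-! ### Descending Morse cycles -/

/-- `c` is a nondegenerate critical point of the holomorphic function `f`. -/
def IsNondegenerateCriticalPoint {n : ℕ} (f : (Vtx n → ℂ) → ℂ) (c : Vtx n → ℂ) : Prop :=
  fderiv ℂ f c = 0 ∧ Function.Injective (fderiv ℂ (fderiv ℂ f) c)

/-- Smooth Riemannian metrics on the real manifold underlying `ℂ ^ (n(n+1)/2)`. -/
abbrev Metric (n : ℕ) : Type :=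
  Bundle.ContMDiffRiemannianMetric 𝓘(ℝ, Vtx n → ℂ) ∞ (Vtx n → ℂ)
    (fun y : Vtx n → ℂ => TangentSpace 𝓘(ℝ, Vtx n → ℂ) y)

/-- The descending manifold of the critical point `c` of the function `h`: the end points of all
trajectories `γ : (-∞, 0] → ℂ ^ (n(n+1)/2)` of the negative gradient `-grad_g h` that emanate
from `c`, that is `γ s → c` as `s → -∞`. -/
def descendingManifold {n : ℕ} (g : Metric n) (h : (Vtx n → ℂ) → ℝ) (c : Vtx n → ℂ) :
    Set (Vtx n → ℂ) :=
  {y | ∃ γ : ℝ → Vtx n → ℂ, γ 0 = y ∧ Filter.Tendsto γ Filter.atBot (𝓝 c) ∧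
    ∀ s ≤ 0, DifferentiableAt ℝ γ s ∧
      ∀ w : Vtx n → ℂ, g.inner (γ s) (deriv γ s) w = -fderiv ℝ h (γ s) w}

/-- The parametrized (hence oriented) cell `φ : ℝ ^ (n(n+1)/2) → ℂ ^ (n(n+1)/2)` is a descending
Morse cycle of `Re f` at `c`: it is a smooth injective immersion onto the descending manifold of
`c` for some Riemannian metric, and it is a cycle relative to `Re f = -∞`, that is, `Re f` tends
to `-∞` at infinity on it. -/
def IsDescendingMorseCycle {n : ℕ} (f : (Vtx n → ℂ) → ℂ) (c : Vtx n → ℂ)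
    (φ : (Vtx n → ℝ) → Vtx n → ℂ) : Prop :=
  ContDiff ℝ ∞ φ ∧ Function.Injective φ ∧ (∀ x, Function.Injective (fderiv ℝ φ x)) ∧
  (∃ g : Metric n, Set.range φ = descendingManifold g (fun y => (f y).re) c) ∧
  Filter.Tendsto (fun x => (f (φ x)).re) (Filter.cocompact (Vtx n → ℝ)) Filter.atBot

/-- A covariantly constant family of cycles `Γ_t` over the set `U` of parameters: a family,
smooth in `t`, of cells `Φ t : ℝ ^ (n(n+1)/2) → ℂ ^ (n(n+1)/2)` that are cycles relative to
`Re f_q = -∞` locally uniformly in `t`. (In the coordinates `T_{ij}` all fibres `Y_q` have the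
same universal covering, and the classes of the members of such a homotopy of relative cycles are
parallel for the Gauss-Manin connection; a cell that does not move with `t` is a special case.)

The last clause says that along the family the integrals of `e ^ (f_q / ħ)` times polynomials in
the edge variables converge absolutely, locally uniformly in `t`: the size of the integrand is
bounded by an integrable function. The power of the norm of the derivative bounds the
`n(n+1)/2`-dimensional volume swept out by the family. -/
structure IsFlatFamily {n : ℕ} (lam : Fin (n + 1) → ℂ) (hbar : ℂ) (U : Set (Fin (n + 1) → ℂ))
    (Φ : (Fin (n + 1) → ℂ) → (Vtx n → ℝ) → Vtx n → ℂ) : Prop where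
  smooth : ContDiffOn ℝ ∞ (Function.uncurry Φ) (U ×ˢ Set.univ)
  relative_cycle : ∀ t₁ ∈ U, Filter.Tendsto
    (fun p : (Fin (n + 1) → ℂ) × (Vtx n → ℝ) => (phase lam p.1 (Φ p.1 p.2)).re)
    (𝓝 t₁ ×ˢ Filter.cocompact (Vtx n → ℝ)) Filter.atBot
  convergent : ∀ t₁ ∈ U, ∀ k : ℕ, ∃ G : (Vtx n → ℝ) → ℝ, MeasureTheory.Integrable G ∧
    ∀ᶠ t in 𝓝 t₁, ∀ x : Vtx n → ℝ,
      Real.exp (phase lam t (Φ t x) / hbar).re * edgeSize t (Φ t x) ^ k *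
        (1 + ‖fderiv ℝ (Function.uncurry Φ) (t, x)‖) ^ Fintype.card (Vtx n) ≤ G x

/-! ### The oscillating integral -/

/-- The density of the pull back of `e ^ (f_q / ħ) ω_q`, `ω_q = ⋀_{i > 0} dT_{ij}`, by the
parametrization `φ`. The parameters are indexed by the same set as the `T_{ij}`, so the Jacobian
determinant does not depend on an ordering of this set. -/
def density {n : ℕ} (lam : Fin (n + 1) → ℂ) (hbar : ℂ) (t : Fin (n + 1) → ℂ)
    (φ : (Vtx n → ℝ) → Vtx n → ℂ) (x : Vtx n → ℝ) : ℂ :=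
  Complex.exp (phase lam t (φ x) / hbar) *
    (Matrix.of fun a b : Vtx n => fderiv ℝ φ x (Pi.single b 1) a).det

/-- The integral `∫_Γ e ^ (f_q / ħ) ω_q` over the cell `Γ` parametrized by `φ`. -/
def oscIntegral {n : ℕ} (lam : Fin (n + 1) → ℂ) (hbar : ℂ) (t : Fin (n + 1) → ℂ)
    (φ : (Vtx n → ℝ) → Vtx n → ℂ) : ℂ :=
  ∫ x : Vtx n → ℝ, density lam hbar t φ x

end TodaMirror

end

open TodaMirror

/-!
The integral `I(t) = ∫_{Γ_t} e ^ (f / ħ) ω` is studied together with the integrals `I_P(t)` of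
`P e ^ (f / ħ) ω`, where `P` is a polynomial in the edge variables `u`, `v`. Two facts are needed
about them.

* `ħ ∂ / ∂t_j` acts on `I_P` by replacing `P` by `∇_j P`, where `∇_d = e ^ (-f/ħ) ħ ∂_d e ^ (f/ħ)`
  (`twistedDer`), as if the cells did not depend on `t`; in particular `I_P` is holomorphic.
* `I_P = 0` if `P = ∇_{ij} Q` with `i ≥ 1`, because the form is exact.

Both follow from Stokes' theorem. For a holomorphic `g`, the Lie derivative of `g dy` along a vector
field pulls back to a divergence on the parameter space of the cell (`divergence_eq`). The cells are
not compact, so cutoffs are inserted; the boundary terms contain no second derivatives of the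
parametrization, and the convergence condition of a flat family makes them tend to zero, locally
uniformly in `t` (`integral_fderiv_mul_rowDet_eq_zero`, `hasFDerivAt_cellIntegral`).

The rest is algebra. The generating function `∑ x ^ (n + 1 - i) D_i` is a tridiagonal determinant,
hence a continuant (`det_triMatrix`), so that `∑ x ^ (n + 1 - i) D_i I = I_P` where `P` is obtained
by applying a continuant in the operators `x + ∇_j` to `1` (`quantOp_continuant`). It is computed
layer by layer in the triangular graph (`layerOp_sub_mem`). Let `h_j` and `g_j` be the parts of `∂f
/ ∂T_{ij}` that come from the edges between the layer `i` and the layers `i + 1` and `i - 1`,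
respectively (`lowerPart`, `upperPart`). The operators `x + ħ ∂_j + h_j` of the layer act on `1` as
multiplications by `x + h_j`, because `h_j` does not depend on the other vertices of the layer. The
resulting tridiagonal determinant has the form `det (x - λ_i + X Y)` with `X`, `Y` bidiagonal and
rectangular. It equals `(x - λ_i) det (x - λ_i + Y X)` (`continuant_factor`), and up to the box
relations the last factor is the Toda determinant of the layer `i + 1` with `p_j` replaced by
`-g_j`, where `g_j` now belongs to the layer `i + 1`. Since `ħ ∂_j + h_j + g_j = ∇_{i+1,j}` has
integral zero, `-g_j` may be replaced by `ħ ∂_j + h_j` (`continuant_mul_sub_opContinuant_mem`),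
which is the situation of the next layer. After the last layer the result is `∏ (x - λ_i)`, that is
`∑ σ_i x ^ (n + 1 - i)`.
-/

open TodaMirror

noncomputable section

namespace TodaMirror

/-! ### Stokes' theorem for holomorphic top forms along a parametrized cell -/

section Stokes

variable {ι : Type*} [Fintype ι] [DecidableEq ι]

/-- The determinant as a continuous real multilinear function of the rows of a complex matrix. -/
def rowDet (ι : Type*) [Fintype ι] [DecidableEq ι] :
    ContinuousMultilinearMap ℝ (fun _ : ι => ι → ℂ) ℂ where
  toMultilinearMap :=
    ((Matrix.detRowAlternating (R := ℂ) (n := ι)).toMultilinearMap).restrictScalars ℝ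
  cont := by
    change Continuous fun C : ι → ι → ℂ => Matrix.det (Matrix.of C)
    exact Continuous.matrix_det continuous_id

theorem rowDet_apply (C : ι → ι → ℂ) : rowDet ι C = (Matrix.of C).det := rfl

/-- Exchanging the rows `b` and `c` changes the sign of the determinant. -/
theorem rowDet_swap (C : ι → ι → ℂ) {b c : ι} (h : b ≠ c) (w z : ι → ℂ) :
    rowDet ι (Function.update (Function.update C b w) c z) =
      -rowDet ι (Function.update (Function.update C c w) b z) := by
  have key := (Matrix.detRowAlternating (R := ℂ) (n := ι)).map_swap
    (Function.update (Function.update C c w) b z) h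
  have : (Function.update (Function.update C c w) b z) ∘ Equiv.swap b c =
      Function.update (Function.update C b w) c z := by
    funext i
    by_cases hb : i = b
    · subst hb
      simp [Function.update_of_ne h, Function.update_of_ne h.symm]
    · by_cases hc : i = c
      · subst hc
        simp
      · simp [Equiv.swap_apply_of_ne_of_ne hb hc, hb, hc]
  rw [this] at key
  exact key

/-- Cramer's rule: `∑ b, det (C with row b replaced by w) • C b = det C • w`. -/
theorem sum_rowDet_update_mul (C : ι → ι → ℂ) (w : ι → ℂ) :
    ∑ b, rowDet ι (Function.update C b w) • C b = rowDet ι C • w := by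
  have h := Matrix.mulVec_cramer (Matrix.of C).transpose w
  rw [Matrix.det_transpose] at h
  rw [rowDet_apply, ← h]
  funext a
  simp only [Finset.sum_apply, Pi.smul_apply, smul_eq_mul, Matrix.mulVec, dotProduct,
    Matrix.cramer_transpose_apply, Matrix.transpose_apply, Matrix.of_apply]
  refine Finset.sum_congr rfl fun b _ => ?_
  rw [mul_comm]
  rfl

/-- The transposed Jacobian matrix of `φ` at `x`: its rows are the partial derivatives of `φ`. -/
def jacRows (φ : (ι → ℝ) → ι → ℂ) (x : ι → ℝ) : ι → ι → ℂ :=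
  fun b => fderiv ℝ φ x (Pi.single b 1)

/-- The product rule for the determinant, row by row. -/
theorem differentiableAt_and_fderiv_rowDet {E : Type*} [NormedAddCommGroup E] [NormedSpace ℝ E]
    {C : E → ι → ι → ℂ} {x : E} (hC : ∀ b, DifferentiableAt ℝ (fun y => C y b) x) (v : E) :
    DifferentiableAt ℝ (fun y => rowDet ι (C y)) x ∧
    fderiv ℝ (fun y => rowDet ι (C y)) x v =
      ∑ b, rowDet ι (Function.update (C x) b (fderiv ℝ (fun y => C y b) x v)) := by
  have h := HasFDerivAt.multilinear_comp (rowDet ι) (g := fun b y => C y b)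
    (fun b => (hC b).hasFDerivAt)
  refine ⟨h.differentiableAt, ?_⟩
  rw [h.fderiv]
  simp

/-- The divergence identity behind Stokes' theorem: for a holomorphic function `g`, a map `φ` and
a vector field `w` along `φ`, the Lie derivative of `g dy` along `w` pulls back to a divergence.
The second derivatives of `φ` cancel by antisymmetry of the determinant. -/
theorem divergence_eq {φ : (ι → ℝ) → ι → ℂ} {w : (ι → ℝ) → ι → ℂ} {g : (ι → ℂ) → ℂ}
    {x : ι → ℝ} (hφ : ContDiff ℝ 2 φ) (hw : DifferentiableAt ℝ w x)
    (hg : DifferentiableAt ℂ g (φ x)) :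
    ∑ b, fderiv ℝ (fun z => g (φ z) * rowDet ι (Function.update (jacRows φ z) b (w z))) x
        (Pi.single b 1) =
      fderiv ℂ g (φ x) (w x) * rowDet ι (jacRows φ x) +
      g (φ x) * ∑ b, rowDet ι (Function.update (jacRows φ x) b
        (fderiv ℝ w x (Pi.single b 1))) := by
  have hφ1 : DifferentiableAt ℝ φ x := hφ.differentiable (by norm_num) x
  have hφ2 : DifferentiableAt ℝ (fderiv ℝ φ) x :=
    (hφ.fderiv_right (m := 1) (by norm_num)).differentiable (by norm_num) x
  have hJ : ∀ c, DifferentiableAt ℝ (fun z => jacRows φ z c) x := fun c =>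
    hφ2.clm_apply (differentiableAt_const _)
  have hJ' : ∀ b c, fderiv ℝ (fun z => jacRows φ z c) x (Pi.single b 1) =
      fderiv ℝ (fderiv ℝ φ) x (Pi.single b 1) (Pi.single c 1) := by
    intro b c
    have := (hφ2.hasFDerivAt.clm_apply (hasFDerivAt_const (Pi.single c (1 : ℝ)) x)).fderiv
    unfold jacRows
    rw [this]
    simp
  have hsymm : ∀ b c, fderiv ℝ (fderiv ℝ φ) x (Pi.single b 1) (Pi.single c 1) =
      fderiv ℝ (fderiv ℝ φ) x (Pi.single c 1) (Pi.single b 1) := fun b c =>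
    (hφ.contDiffAt.isSymmSndFDerivAt (by simp)).eq _ _
  have hgφ : HasFDerivAt (fun z => g (φ z))
      (((fderiv ℂ g (φ x)).restrictScalars ℝ).comp (fderiv ℝ φ x)) x :=
    (hg.hasFDerivAt.restrictScalars ℝ).comp x hφ1.hasFDerivAt
  -- `H b c` is the mixed second derivative `∂_b ∂_c φ`
  set H : ι → ι → (ι → ℂ) := fun b c =>
    fderiv ℝ (fderiv ℝ φ) x (Pi.single b 1) (Pi.single c 1) with hH
  have hrow : ∀ b c, DifferentiableAt ℝ
      (fun z => Function.update (jacRows φ z) b (w z) c) x ∧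
      fderiv ℝ (fun z => Function.update (jacRows φ z) b (w z) c) x (Pi.single b 1) =
        if c = b then fderiv ℝ w x (Pi.single b 1) else H b c := by
    intro b c
    by_cases h : c = b
    · subst h
      simpa using hw
    · simp only [Function.update_of_ne h, if_neg h]
      exact ⟨hJ c, hJ' b c⟩
  have hterm : ∀ b, fderiv ℝ (fun z => g (φ z) *
      rowDet ι (Function.update (jacRows φ z) b (w z))) x (Pi.single b 1) =
      fderiv ℂ g (φ x) (rowDet ι (Function.update (jacRows φ x) b (w x)) • jacRows φ x b) +
      g (φ x) * (rowDet ι (Function.update (jacRows φ x) b (fderiv ℝ w x (Pi.single b 1))) +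
        ∑ c, if c = b then 0 else
          rowDet ι (Function.update (Function.update (jacRows φ x) b (w x)) c (H b c))) := by
    intro b
    obtain ⟨d1, d2⟩ := differentiableAt_and_fderiv_rowDet
      (C := fun z => Function.update (jacRows φ z) b (w z)) (x := x)
      (fun c => (hrow b c).1) (Pi.single b 1)
    rw [(hgφ.fun_mul d1.hasFDerivAt).fderiv]
    simp only [add_apply, smul_apply, d2, smul_eq_mul]
    rw [add_comm]
    congr 1
    · simp [jacRows]
    · congr 1
      rw [← Finset.add_sum_erase _ _ (Finset.mem_univ b)]
      congr 1
      · simp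
      · rw [← Finset.add_sum_erase _ (fun c => if c = b then (0 : ℂ) else _)
          (Finset.mem_univ b)]
        simp only [if_true, zero_add]
        refine Finset.sum_congr rfl fun c hc => ?_
        have hcb := Finset.ne_of_mem_erase hc
        rw [(hrow b c).2]
        simp only [if_neg hcb]
  -- the coefficient `H b c` is symmetric and the determinant is antisymmetric in `b` and `c`
  have hanti : ∑ b, ∑ c, (if c = b then 0 else
      rowDet ι (Function.update (Function.update (jacRows φ x) b (w x)) c (H b c))) = 0 := by
    have : ∑ b, ∑ c, (if c = b then 0 else
        rowDet ι (Function.update (Function.update (jacRows φ x) b (w x)) c (H b c))) =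
        -∑ b, ∑ c, (if c = b then 0 else
        rowDet ι (Function.update (Function.update (jacRows φ x) b (w x)) c (H b c))) := by
      conv_lhs => rw [Finset.sum_comm]
      rw [← Finset.sum_neg_distrib]
      refine Finset.sum_congr rfl fun b _ => ?_
      rw [← Finset.sum_neg_distrib]
      refine Finset.sum_congr rfl fun c _ => ?_
      by_cases h : c = b
      · simp [h]
      · rw [if_neg h, if_neg (Ne.symm h), rowDet_swap _ h, hH]
        simp only [hsymm]
    exact self_eq_neg.1 this
  rw [Finset.sum_congr rfl fun b _ => hterm b, Finset.sum_add_distrib, ← map_sum,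
    sum_rowDet_update_mul, ← Finset.mul_sum, Finset.sum_add_distrib, hanti, add_zero, map_smul,
    smul_eq_mul, mul_comm (rowDet ι _)]

end Stokes

/-! ### Cutoff functions and integrals over noncompact cells -/

section Cutoff

open MeasureTheory Filter

variable {ι : Type*} [Fintype ι] [DecidableEq ι]

/-- A smooth compactly supported cutoff that is `1` near the ball of radius `m` and whose
derivative is bounded by `K`. -/
structure IsCutoff (m K : ℝ) (χ : (ι → ℝ) → ℝ) : Prop where
  smooth : ContDiff ℝ ∞ χ
  compact : HasCompactSupport χ
  nonneg : ∀ x, 0 ≤ χ x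
  le_one : ∀ x, χ x ≤ 1
  eq_one : ∀ x, ‖x‖ ≤ m → χ x = 1
  fderiv_eq_zero : ∀ x, ‖x‖ ≤ m → fderiv ℝ χ x = 0
  fderiv_le : ∀ x, ‖fderiv ℝ χ x‖ ≤ K

omit [DecidableEq ι] in
/-- Cutoffs on balls of all radii exist with a common bound for the derivatives: they are the
dilations `χ (x / (m + 1))` of one bump function. -/
theorem exists_cutoff : ∃ K : ℝ, 0 ≤ K ∧ ∃ χ : ℕ → (ι → ℝ) → ℝ, ∀ m : ℕ, IsCutoff m K (χ m) := by
  let b : ContDiffBump (0 : ι → ℝ) := ⟨1, 2, one_pos, one_lt_two⟩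
  have hb : ContDiff ℝ ∞ b := b.contDiff
  obtain ⟨K, hK⟩ := (b.hasCompactSupport.fderiv ℝ).exists_bound_of_continuous
    (hb.continuous_fderiv (by simp))
  have hK0 : 0 ≤ K := (norm_nonneg _).trans (hK 0)
  refine ⟨K, hK0, fun m x => b (((m : ℝ) + 1)⁻¹ • x), fun m => ?_⟩
  have hm : (0 : ℝ) < (m : ℝ) + 1 := by positivity
  have hone : ∀ x : ι → ℝ, ‖x‖ ≤ m + 1 → b (((m : ℝ) + 1)⁻¹ • x) = 1 := by
    intro x hx
    apply b.one_of_mem_closedBall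
    rw [mem_closedBall_zero_iff, norm_smul, norm_inv, Real.norm_of_nonneg hm.le]
    change _ ≤ (1 : ℝ)
    rw [inv_mul_le_iff₀ hm, mul_one]
    exact hx
  refine ⟨hb.comp (contDiff_const_smul _), b.hasCompactSupport.comp_smul (inv_ne_zero hm.ne'),
    fun x => b.nonneg, fun x => b.le_one, fun x hx => hone x (hx.trans (by linarith)),
    fun x hx => ?_, fun x => ?_⟩
  · have : (fun x : ι → ℝ => b (((m : ℝ) + 1)⁻¹ • x)) =ᶠ[𝓝 x] fun _ => (1 : ℝ) := by
      filter_upwards [Metric.ball_mem_nhds x one_pos] with y hy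
      apply hone
      rw [mem_ball_iff_norm] at hy
      linarith [norm_le_insert' y x]
    rw [this.fderiv_eq]
    simp
  · have h1 : HasFDerivAt (fun x : ι → ℝ => b (((m : ℝ) + 1)⁻¹ • x))
        ((fderiv ℝ b (((m : ℝ) + 1)⁻¹ • x)).comp
          (((m : ℝ) + 1)⁻¹ • ContinuousLinearMap.id ℝ (ι → ℝ))) x :=
      ((hb.differentiable (by simp)) _).hasFDerivAt.comp x
        (((m : ℝ) + 1)⁻¹ • ContinuousLinearMap.id ℝ (ι → ℝ)).hasFDerivAt
    rw [h1.fderiv, ContinuousLinearMap.comp_smul, ContinuousLinearMap.comp_id, norm_smul, norm_inv,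
      Real.norm_of_nonneg hm.le]
    calc ((m : ℝ) + 1)⁻¹ * ‖fderiv ℝ b (((m : ℝ) + 1)⁻¹ • x)‖
        ≤ 1 * K := by
          gcongr
          · exact inv_le_one_of_one_le₀ (by linarith [m.cast_nonneg (α := ℝ)])
          · exact hK _
      _ = K := one_mul K

omit [DecidableEq ι] in
/-- The mass of an integrable function outside of large balls tends to zero. -/
theorem tendsto_tail {G : (ι → ℝ) → ℝ} (hG : Integrable G) :
    Tendsto (fun m : ℕ => ∫ x in (Metric.closedBall (0 : ι → ℝ) m)ᶜ, G x) atTop (𝓝 0) := by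
  have h := tendsto_setIntegral_of_antitone (μ := volume) (f := G)
    (s := fun m : ℕ => (Metric.closedBall (0 : ι → ℝ) m)ᶜ)
    (fun m => Metric.isClosed_closedBall.measurableSet.compl)
    (fun m m' h => Set.compl_subset_compl.2 (Metric.closedBall_subset_closedBall (by simpa)))
    ⟨0, hG.integrableOn⟩
  have h0 : ⋂ m : ℕ, (Metric.closedBall (0 : ι → ℝ) m)ᶜ = ∅ := by
    rw [← Set.compl_iUnion, Metric.iUnion_closedBall_nat, Set.compl_univ]
  rwa [h0, setIntegral_empty] at h

/-- The error made when `∫ h` is replaced by its truncation minus the boundary terms that arise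
by partial integration is controlled by the mass of the majorant `G` outside a ball. -/
theorem norm_cutoff_sub_le {m K c : ℝ} {χ : (ι → ℝ) → ℝ} (hχ : IsCutoff m K χ)
    {G : (ι → ℝ) → ℝ} (hG : Integrable G) {h : (ι → ℝ) → ℂ} {F : ι → (ι → ℝ) → ℂ}
    (hh : Continuous h) (hhG : ∀ x, ‖h x‖ ≤ c * G x)
    (hFG : ∀ b x, ‖F b x‖ ≤ c * G x) :
    ‖(∫ x, χ x • h x) - (∑ b, ∫ x, fderiv ℝ χ x (Pi.single b 1) • F b x) - ∫ x, h x‖ ≤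
      c * (1 + Fintype.card ι * K) * ∫ x in (Metric.closedBall (0 : ι → ℝ) m)ᶜ, G x := by
  set T : Set (ι → ℝ) := (Metric.closedBall (0 : ι → ℝ) m)ᶜ with hT
  have hTm : MeasurableSet T := Metric.isClosed_closedBall.measurableSet.compl
  have hmem : ∀ x, x ∉ T → ‖x‖ ≤ m := fun x hx => by simpa [hT] using hx
  have hhi : Integrable h := (hG.const_mul c).mono' hh.aestronglyMeasurable
    (Eventually.of_forall hhG)
  have hχhi : Integrable fun x => χ x • h x :=
    (hχ.smooth.continuous.smul hh).integrable_of_hasCompactSupport hχ.compact.smul_right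
  -- the integrand is unchanged inside of the ball, where the cutoff is `1`
  have tail : ∀ (a : ℝ) (f : (ι → ℝ) → ℂ), (∀ x ∈ T, ‖f x‖ ≤ a * G x) → (∀ x ∉ T, f x = 0) →
      ‖∫ x, f x‖ ≤ a * ∫ x in T, G x := by
    intro a f h1 h2
    rw [← integral_const_mul, ← integral_indicator hTm]
    refine norm_integral_le_of_norm_le ((hG.const_mul a).indicator hTm)
      (Eventually.of_forall fun x => ?_)
    by_cases hx : x ∈ T
    · simpa [hx] using h1 x hx
    · simp [hx, h2 x hx]
  have e1 : ‖∫ x, (χ x • h x - h x)‖ ≤ c * ∫ x in T, G x := by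
    refine tail c _ (fun x _ => ?_) fun x hx => by simp [hχ.eq_one x (hmem x hx)]
    have : χ x • h x - h x = (χ x - 1) • h x := by rw [sub_smul, one_smul]
    rw [this, norm_smul, Real.norm_eq_abs]
    have h1 : |χ x - 1| ≤ 1 := abs_le.2 ⟨by linarith [hχ.nonneg x], by linarith [hχ.le_one x]⟩
    exact (mul_le_of_le_one_left (norm_nonneg _) h1).trans (hhG x)
  have e2 : ∀ b, ‖∫ x, fderiv ℝ χ x (Pi.single b 1) • F b x‖ ≤ K * c * ∫ x in T, G x := by
    intro b
    refine tail _ _ (fun x _ => ?_) fun x hx => by simp [hχ.fderiv_eq_zero x (hmem x hx)]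
    have h1 : ‖fderiv ℝ χ x (Pi.single b 1)‖ ≤ K := by
      refine ((fderiv ℝ χ x).le_opNorm _).trans ?_
      rw [Pi.norm_single, norm_one, mul_one]
      exact hχ.fderiv_le x
    rw [norm_smul, mul_assoc]
    exact mul_le_mul h1 (hFG b x) (norm_nonneg _) ((norm_nonneg _).trans h1)
  rw [sub_right_comm, ← integral_sub hχhi hhi]
  refine (norm_sub_le _ _).trans ?_
  calc _ ≤ c * (∫ x in T, G x) + ∑ _b : ι, K * c * ∫ x in T, G x :=
        add_le_add e1 ((norm_sum_le _ _).trans (Finset.sum_le_sum fun b _ => e2 b))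
    _ = _ := by
        rw [Finset.sum_const, Finset.card_univ, nsmul_eq_mul]
        ring

omit [DecidableEq ι] in
/-- Partial integration against a cutoff. -/
theorem integral_cutoff_mul_fderiv {χ : (ι → ℝ) → ℝ} (hχ : ContDiff ℝ ∞ χ)
    (hc : HasCompactSupport χ) {F : (ι → ℝ) → ℂ} (hF : ContDiff ℝ 1 F) (v : ι → ℝ) :
    ∫ x, χ x • fderiv ℝ F x v = -∫ x, fderiv ℝ χ x v • F x := by
  have cχ := hχ.continuous
  have cF := hF.continuous
  have cχ' : Continuous fun x => fderiv ℝ χ x v := (hχ.continuous_fderiv (by simp)).clm_apply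
    continuous_const
  have cF' : Continuous fun x => fderiv ℝ F x v := (hF.continuous_fderiv (by simp)).clm_apply
    continuous_const
  refine integral_smul_fderiv_eq_neg_fderiv_smul_of_integrable ?_ ?_ ?_
    (fun x _ => hχ.differentiable (by simp) x) (fun x _ => hF.differentiable (by simp) x)
  · exact (cχ'.smul cF).integrable_of_hasCompactSupport (hc.fderiv_apply ℝ v).smul_right
  · exact (cχ.smul cF').integrable_of_hasCompactSupport hc.smul_right
  · exact (cχ.smul cF).integrable_of_hasCompactSupport hc.smul_right

theorem contDiff_jacRows {φ : (ι → ℝ) → ι → ℂ} (hφ : ContDiff ℝ 2 φ) :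
    ContDiff ℝ 1 (jacRows φ) :=
  contDiff_pi.2 fun _ => (hφ.fderiv_right (m := 1) (by norm_num)).clm_apply contDiff_const

theorem contDiff_update {E : Type*} [NormedAddCommGroup E] [NormedSpace ℝ E]
    {C : E → ι → ι → ℂ} {w : E → ι → ℂ} (hC : ContDiff ℝ 1 C) (hw : ContDiff ℝ 1 w) (b : ι) :
    ContDiff ℝ 1 fun x => Function.update (C x) b (w x) := by
  refine contDiff_pi.2 fun c => ?_
  by_cases h : c = b
  · subst h
    simpa using hw
  · simpa [Function.update_of_ne h] using contDiff_pi.1 hC c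

/-- Stokes' theorem for a truncated cell: partial integration of the divergence identity. -/
theorem integral_cutoff_divergence {χ : (ι → ℝ) → ℝ} (hχ : ContDiff ℝ ∞ χ)
    (hc : HasCompactSupport χ) {φ w : (ι → ℝ) → ι → ℂ} {g : (ι → ℂ) → ℂ}
    (hφ : ContDiff ℝ 2 φ) (hw : ContDiff ℝ 1 w) (hg : ContDiff ℂ 1 g) :
    ∫ x, χ x • (fderiv ℂ g (φ x) (w x) * rowDet ι (jacRows φ x) +
        g (φ x) * ∑ b, rowDet ι (Function.update (jacRows φ x) b
          (fderiv ℝ w x (Pi.single b 1)))) =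
      -∑ b, ∫ x, fderiv ℝ χ x (Pi.single b 1) •
        (g (φ x) * rowDet ι (Function.update (jacRows φ x) b (w x))) := by
  have hF : ∀ b, ContDiff ℝ 1
      fun x => g (φ x) * rowDet ι (Function.update (jacRows φ x) b (w x)) := fun b =>
    ((hg.restrict_scalars ℝ).comp (hφ.of_le (by norm_num))).mul
      ((rowDet ι).contDiff.comp (contDiff_update (contDiff_jacRows hφ) hw b))
  rw [← Finset.sum_neg_distrib]
  simp_rw [← integral_cutoff_mul_fderiv hχ hc (hF _)]
  rw [← integral_finsetSum]
  · refine integral_congr_ae (Eventually.of_forall fun x => ?_)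
    simp only
    rw [← Finset.smul_sum, divergence_eq hφ (hw.differentiable (by simp) x)
      (hg.differentiable (by simp) _)]
  · intro b _
    exact (hχ.continuous.smul (((hF b).continuous_fderiv (by simp)).clm_apply
      continuous_const)).integrable_of_hasCompactSupport hc.smul_right

theorem norm_rowDet_le {C : ι → ι → ℂ} {M : ℝ} (hC : ∀ b, ‖C b‖ ≤ M) :
    ‖rowDet ι C‖ ≤ ‖rowDet ι‖ * M ^ Fintype.card ι := by
  refine ((rowDet ι).le_opNorm C).trans ?_
  gcongr
  calc ∏ b, ‖C b‖ ≤ ∏ _b : ι, M := Finset.prod_le_prod (fun _ _ => norm_nonneg _) fun b _ => hC b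
    _ = M ^ Fintype.card ι := by simp

/-- The determinant bound when one row is replaced by a vector that is `s` times longer than
the bound `M` for the other rows. -/
theorem norm_rowDet_update_le {C : ι → ι → ℂ} {M s : ℝ} (hC : ∀ b, ‖C b‖ ≤ M) (b : ι)
    {w : ι → ℂ} (hw : ‖w‖ ≤ M * s) :
    ‖rowDet ι (Function.update C b w)‖ ≤ ‖rowDet ι‖ * M ^ Fintype.card ι * s := by
  have hM : 0 ≤ M := (norm_nonneg _).trans (hC b)
  refine ((rowDet ι).le_opNorm _).trans ?_
  rw [mul_assoc]
  gcongr
  have h1 : ∀ c, ‖Function.update C b w c‖ = Function.update (fun c => ‖C c‖) b ‖w‖ c := by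
    intro c
    by_cases h : c = b
    · subst h; simp
    · simp [Function.update_of_ne h]
  simp_rw [h1]
  rw [Finset.prod_update_of_mem (Finset.mem_univ b)]
  calc ‖w‖ * ∏ c ∈ Finset.univ \ {b}, ‖C c‖ ≤ (M * s) * ∏ _c ∈ Finset.univ \ {b}, M := by
        have : ∏ c ∈ Finset.univ \ {b}, ‖C c‖ ≤ ∏ _c ∈ Finset.univ \ {b}, M :=
          Finset.prod_le_prod (fun _ _ => norm_nonneg _) fun c _ => hC c
        exact mul_le_mul hw this (Finset.prod_nonneg fun _ _ => norm_nonneg _)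
          ((norm_nonneg _).trans hw)
    _ = M ^ Fintype.card ι * s := by
        have : M * ∏ _c ∈ Finset.univ \ {b}, M = M ^ Fintype.card ι := by
          rw [← Finset.prod_update_of_mem (Finset.mem_univ b) (fun _ => M) M]
          simp
        rw [← this]
        ring

/-- Integrals of exact forms: if a holomorphic form `g dy` and its partial derivative along `y_a`
decay along the cell `φ`, then `∫ (∂g / ∂y_a) dy = 0`. -/
theorem integral_fderiv_mul_rowDet_eq_zero {φ : (ι → ℝ) → ι → ℂ} {g : (ι → ℂ) → ℂ}
    (hφ : ContDiff ℝ 2 φ) (hg : ContDiff ℂ 1 g) (a : ι) {G : (ι → ℝ) → ℝ} (hG : Integrable G)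
    (h0 : ∀ x, ‖g (φ x)‖ * (1 + ‖fderiv ℝ φ x‖) ^ Fintype.card ι ≤ G x)
    (h1 : ∀ x, ‖fderiv ℂ g (φ x) (Pi.single a 1)‖ *
      (1 + ‖fderiv ℝ φ x‖) ^ Fintype.card ι ≤ G x) :
    ∫ x, fderiv ℂ g (φ x) (Pi.single a 1) * rowDet ι (jacRows φ x) = 0 := by
  obtain ⟨K, -, χ, hχ⟩ := exists_cutoff (ι := ι)
  have hrow : ∀ x b, ‖jacRows φ x b‖ ≤ 1 + ‖fderiv ℝ φ x‖ := by
    intro x b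
    refine ((fderiv ℝ φ x).le_opNorm _).trans ?_
    rw [Pi.norm_single]
    simp
  set h : (ι → ℝ) → ℂ := fun x => fderiv ℂ g (φ x) (Pi.single a 1) * rowDet ι (jacRows φ x)
    with hh
  set F : ι → (ι → ℝ) → ℂ := fun b x =>
    g (φ x) * rowDet ι (Function.update (jacRows φ x) b (Pi.single a 1)) with hF
  have hcont : Continuous h :=
    (((hg.continuous_fderiv (by simp)).comp hφ.continuous).clm_apply continuous_const).mul
      ((rowDet ι).cont.comp (contDiff_jacRows hφ).continuous)
  have key : ∀ m : ℕ, ‖∫ x, h x‖ ≤ ‖rowDet ι‖ * (1 + Fintype.card ι * K) *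
      ∫ x in (Metric.closedBall (0 : ι → ℝ) m)ᶜ, G x := by
    intro m
    -- Stokes' theorem for the constant vector field `e_a`, whose derivative vanishes
    have hst := integral_cutoff_divergence (hχ m).smooth (hχ m).compact hφ
      (contDiff_const (c := Pi.single a (1 : ℂ))) hg
    have hupd : ∀ x b, rowDet ι (Function.update (jacRows φ x) b 0) = 0 := fun x b =>
      (rowDet ι).map_coord_zero b (by simp)
    simp only [fderiv_const_apply, zero_apply, hupd, Finset.sum_const_zero, mul_zero,
      add_zero] at hst
    have hle := norm_cutoff_sub_le (hχ m) hG (h := h) (F := fun b x => -F b x)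
      (c := ‖rowDet ι‖) hcont (fun x => ?_) (fun b x => ?_)
    · simp only [hh, hF] at hle ⊢
      simp only [smul_neg, integral_neg, Finset.sum_neg_distrib, sub_neg_eq_add] at hle
      rw [hst, neg_add_cancel, zero_sub, norm_neg] at hle
      exact hle
    · rw [hh, norm_mul]
      calc _ ≤ ‖fderiv ℂ g (φ x) (Pi.single a 1)‖ *
            (‖rowDet ι‖ * (1 + ‖fderiv ℝ φ x‖) ^ Fintype.card ι) := by
            gcongr
            exact norm_rowDet_le (hrow x)
        _ ≤ _ := by
            rw [mul_left_comm]
            gcongr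
            exact h1 x
    · rw [norm_neg, hF, norm_mul]
      calc _ ≤ ‖g (φ x)‖ * (‖rowDet ι‖ * (1 + ‖fderiv ℝ φ x‖) ^ Fintype.card ι * 1) := by
            gcongr
            refine norm_rowDet_update_le (hrow x) b ?_
            rw [Pi.norm_single, norm_one]
            linarith [norm_nonneg (fderiv ℝ φ x)]
        _ ≤ _ := by
            rw [mul_one, mul_left_comm]
            gcongr
            exact h0 x
  have hlim := (tendsto_tail hG).const_mul (‖rowDet ι‖ * (1 + Fintype.card ι * K))
  rw [mul_zero] at hlim
  exact norm_le_zero_iff.1 (ge_of_tendsto' hlim fun m => key m)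

end Cutoff

/-! ### Integrals over a moving cell -/

section Family

open MeasureTheory Filter

variable {ι κ : Type*} [Fintype ι] [DecidableEq ι] [Fintype κ]

omit [DecidableEq ι] [Fintype ι] [Fintype κ] in
theorem continuous_slice {Z : Type*} [TopologicalSpace Z] {U : Set (κ → ℂ)}
    {f : (κ → ℂ) × (ι → ℝ) → Z} (hf : ContinuousOn f (U ×ˢ Set.univ)) {s : κ → ℂ} (hs : s ∈ U) :
    Continuous fun x => f (s, x) := by
  rw [← continuousOn_univ]
  exact hf.comp (by fun_prop) fun x _ => ⟨hs, trivial⟩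

omit [DecidableEq ι] in
/-- Differentiation under the integral sign for a compactly supported integrand. -/
theorem hasFDerivAt_integral_cutoff {χ : (ι → ℝ) → ℝ} (hχ : Continuous χ)
    (hc : HasCompactSupport χ) {U : Set (κ → ℂ)} (hU : IsOpen U)
    {D : (κ → ℂ) × (ι → ℝ) → ℂ} (hD : ContDiffOn ℝ 1 D (U ×ˢ Set.univ)) {t : κ → ℂ}
    (ht : t ∈ U) :
    HasFDerivAt (fun s => ∫ x, χ x • D (s, x))
      (∫ x, χ x • (fderiv ℝ D (t, x)).comp (ContinuousLinearMap.inl ℝ (κ → ℂ) (ι → ℝ))) t := by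
  have hopen : IsOpen (U ×ˢ (Set.univ : Set (ι → ℝ))) := hU.prod isOpen_univ
  have hD' : ContinuousOn (fderiv ℝ D) (U ×ˢ Set.univ) := hD.continuousOn_fderiv_of_isOpen hopen
    le_rfl
  obtain ⟨r, hr, hrU⟩ := Metric.isOpen_iff.1 hU t ht
  have hball : Metric.closedBall t (r / 2) ⊆ U := fun s hs => hrU
    (lt_of_le_of_lt (Metric.mem_closedBall.1 hs) (by linarith))
  obtain ⟨B, hB⟩ := ((isCompact_closedBall t (r / 2)).prod hc).exists_bound_of_continuousOn
    (hD'.mono (Set.prod_mono hball (Set.subset_univ _)))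
  have hcomp : Continuous fun x => χ x •
      (fderiv ℝ D (t, x)).comp (ContinuousLinearMap.inl ℝ (κ → ℂ) (ι → ℝ)) :=
    hχ.smul ((continuous_slice hD' ht).clm_comp continuous_const)
  refine hasFDerivAt_integral_of_dominated_of_fderiv_le
    (F' := fun s x => χ x • (fderiv ℝ D (s, x)).comp (ContinuousLinearMap.inl ℝ (κ → ℂ) (ι → ℝ)))
    (bound := fun x => |χ x| * (B * ‖ContinuousLinearMap.inl ℝ (κ → ℂ) (ι → ℝ)‖))
    (Metric.closedBall_mem_nhds t (half_pos hr)) ?_ ?_ hcomp.aestronglyMeasurable ?_ ?_ ?_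
  · filter_upwards [hU.mem_nhds ht] with s hs
    exact (hχ.smul (continuous_slice hD.continuousOn hs)).aestronglyMeasurable
  · exact (hχ.smul (continuous_slice hD.continuousOn ht)).integrable_of_hasCompactSupport hc.smul_right
  · refine Eventually.of_forall fun x s hs => ?_
    rw [norm_smul, Real.norm_eq_abs]
    by_cases hx : x ∈ tsupport χ
    · gcongr
      refine (ContinuousLinearMap.opNorm_comp_le _ _).trans ?_
      gcongr
      exact hB (s, x) ⟨hs, hx⟩
    · simp [image_eq_zero_of_notMem_tsupport hx]
  · exact (hχ.abs.mul continuous_const).integrable_of_hasCompactSupport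
      (hc.norm.mul_right)
  · refine Eventually.of_forall fun x s hs => ?_
    have h1 : HasFDerivAt D (fderiv ℝ D (s, x)) (s, x) :=
      ((hD.differentiableOn (by simp)).differentiableAt
        (hopen.mem_nhds ⟨hball hs, trivial⟩)).hasFDerivAt
    exact (h1.comp s (hasFDerivAt_prodMk_left s x)).const_smul (χ x)

/-- The integral of the holomorphic form `g(t, ·) dy` over the cell `Φ t`. -/
def cellIntegral (g : (κ → ℂ) × (ι → ℂ) → ℂ) (Φ : (κ → ℂ) → (ι → ℝ) → ι → ℂ) (t : κ → ℂ) : ℂ :=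
  ∫ x, g (t, Φ t x) * rowDet ι (jacRows (Φ t) x)

variable {U : Set (κ → ℂ)} {Φ : (κ → ℂ) → (ι → ℝ) → ι → ℂ}

section Pointwise

variable (hU : IsOpen U) (hΦ : ContDiffOn ℝ ∞ (Function.uncurry Φ) (U ×ˢ Set.univ))
include hU hΦ

omit [DecidableEq ι] in
theorem contDiffAt_family {t : κ → ℂ} (ht : t ∈ U) (x : ι → ℝ) :
    ContDiffAt ℝ ∞ (Function.uncurry Φ) (t, x) :=
  hΦ.contDiffAt ((hU.prod isOpen_univ).mem_nhds ⟨ht, trivial⟩)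

omit [DecidableEq ι] in
theorem contDiff_slice {t : κ → ℂ} (ht : t ∈ U) : ContDiff ℝ ∞ (Φ t) :=
  contDiff_iff_contDiffAt.2 fun x =>
    (contDiffAt_family hU hΦ ht x).comp x (contDiffAt_const.prodMk contDiffAt_id)

omit [DecidableEq ι] in
theorem fderiv_slice {t : κ → ℂ} (ht : t ∈ U) (x v : ι → ℝ) :
    fderiv ℝ (Φ t) x v = fderiv ℝ (Function.uncurry Φ) (t, x) (0, v) := by
  have h := ((contDiffAt_family hU hΦ ht x).differentiableAt (by simp)).hasFDerivAt.comp x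
    (hasFDerivAt_prodMk_right t x)
  have : HasFDerivAt (Φ t) _ x := h
  rw [this.fderiv]
  simp

omit [DecidableEq ι] in
theorem norm_fderiv_slice_le {t : κ → ℂ} (ht : t ∈ U) (x : ι → ℝ) :
    ‖fderiv ℝ (Φ t) x‖ ≤ ‖fderiv ℝ (Function.uncurry Φ) (t, x)‖ := by
  refine ContinuousLinearMap.opNorm_le_bound _ (norm_nonneg _) fun v => ?_
  rw [fderiv_slice hU hΦ ht]
  refine (ContinuousLinearMap.le_opNorm _ _).trans_eq ?_
  simp [Prod.norm_def]

/-- The density of the pull back of `g dy`, as a function of parameter and point. -/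
theorem contDiffOn_familyDensity {g : (κ → ℂ) × (ι → ℂ) → ℂ} (hg : ContDiff ℂ 1 g) :
    ContDiffOn ℝ 1 (fun p : (κ → ℂ) × (ι → ℝ) =>
      g (p.1, Φ p.1 p.2) * rowDet ι (jacRows (Φ p.1) p.2)) (U ×ˢ Set.univ) := by
  have hopen : IsOpen (U ×ˢ (Set.univ : Set (ι → ℝ))) := hU.prod isOpen_univ
  have h1 : ContDiffOn ℝ 1 (fun p : (κ → ℂ) × (ι → ℝ) => g (p.1, Φ p.1 p.2))
      (U ×ˢ Set.univ) :=
    (hg.restrict_scalars ℝ).comp_contDiffOn (contDiff_fst.contDiffOn.prodMk (hΦ.of_le (by simp)))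
  have h2 : ContDiffOn ℝ 1 (fun p : (κ → ℂ) × (ι → ℝ) => fun b =>
      fderiv ℝ (Function.uncurry Φ) p (0, Pi.single b 1)) (U ×ˢ Set.univ) :=
    contDiffOn_pi.2 fun b =>
      (hΦ.fderiv_of_isOpen hopen (m := 1) (WithTop.coe_le_coe.2 le_top)).clm_apply contDiffOn_const
  refine h1.mul (((rowDet ι).contDiff.comp_contDiffOn h2).congr fun p hp => ?_)
  simp only [Function.comp_apply]
  congr 1
  funext b
  exact fderiv_slice hU hΦ hp.1 _ _

/-- The derivative of the density in the direction `v` of the parameter space: besides the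
derivative of the form there appears the Lie derivative along the velocity field of the family. -/
theorem fderiv_familyDensity {g : (κ → ℂ) × (ι → ℂ) → ℂ} (hg : ContDiff ℂ 1 g) {t : κ → ℂ}
    (ht : t ∈ U) (x : ι → ℝ) (v : κ → ℂ) :
    fderiv ℝ (fun p : (κ → ℂ) × (ι → ℝ) =>
        g (p.1, Φ p.1 p.2) * rowDet ι (jacRows (Φ p.1) p.2)) (t, x) (v, 0) =
      fderiv ℂ g (t, Φ t x) (v, 0) * rowDet ι (jacRows (Φ t) x) +
      (fderiv ℂ (fun y => g (t, y)) (Φ t x) (fderiv ℝ (Function.uncurry Φ) (t, x) (v, 0)) *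
          rowDet ι (jacRows (Φ t) x) +
        g (t, Φ t x) * ∑ b, rowDet ι (Function.update (jacRows (Φ t) x) b
          (fderiv ℝ (fun z => fderiv ℝ (Function.uncurry Φ) (t, z) (v, 0)) x
            (Pi.single b 1)))) := by
  have hopen : IsOpen (U ×ˢ (Set.univ : Set (ι → ℝ))) := hU.prod isOpen_univ
  have hΨ := contDiffAt_family hU hΦ ht x
  set Ψ := Function.uncurry Φ with hΨdef
  have hΨ2 : DifferentiableAt ℝ (fderiv ℝ Ψ) (t, x) :=
    (hΨ.fderiv_right (m := 1) (WithTop.coe_le_coe.2 le_top)).differentiableAt (by simp)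
  have e1 : HasFDerivAt (fun p : (κ → ℂ) × (ι → ℝ) => g (p.1, Ψ p))
      (((fderiv ℂ g (t, Φ t x)).restrictScalars ℝ).comp
        ((ContinuousLinearMap.fst ℝ _ _).prod (fderiv ℝ Ψ (t, x)))) (t, x) :=
    HasFDerivAt.comp (t, x) (f := fun p : (κ → ℂ) × (ι → ℝ) => (p.1, Ψ p))
      ((hg.differentiable (by simp) (t, Φ t x)).hasFDerivAt.restrictScalars ℝ)
      (hasFDerivAt_fst.prodMk (hΨ.differentiableAt (by simp)).hasFDerivAt)
  have e2 : ∀ b : ι, HasFDerivAt (fun p => fderiv ℝ Ψ p ((0 : κ → ℂ), Pi.single b (1 : ℝ)))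
      ((fderiv ℝ (fderiv ℝ Ψ) (t, x)).flip (0, Pi.single b 1)) (t, x) := fun b => by
    simpa using hΨ2.hasFDerivAt.clm_apply (hasFDerivAt_const ((0 : κ → ℂ), Pi.single b (1 : ℝ)) _)
  obtain ⟨d1, d2⟩ := differentiableAt_and_fderiv_rowDet
    (C := fun p b => fderiv ℝ Ψ p ((0 : κ → ℂ), Pi.single b (1 : ℝ)))
    (fun b => (e2 b).differentiableAt) (v, 0)
  have hcongr : (fun p : (κ → ℂ) × (ι → ℝ) =>
        g (p.1, Φ p.1 p.2) * rowDet ι (jacRows (Φ p.1) p.2)) =ᶠ[𝓝 (t, x)] fun p => g (p.1, Ψ p) *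
      rowDet ι fun b => fderiv ℝ Ψ p ((0 : κ → ℂ), Pi.single b (1 : ℝ)) := by
    filter_upwards [hopen.mem_nhds ⟨ht, trivial⟩] with p hp
    congr 2
    funext b
    exact fderiv_slice hU hΦ hp.1 _ _
  have hjac : (fun b => fderiv ℝ Ψ (t, x) ((0 : κ → ℂ), Pi.single b (1 : ℝ))) =
      jacRows (Φ t) x := by
    funext b
    exact (fderiv_slice hU hΦ ht _ _).symm
  have hslice : fderiv ℂ (fun y => g (t, y)) (Φ t x) (fderiv ℝ Ψ (t, x) (v, 0)) =
      fderiv ℂ g (t, Φ t x) (0, fderiv ℝ Ψ (t, x) (v, 0)) := by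
    have := (hg.differentiable (by simp) (t, Φ t x)).hasFDerivAt.comp (Φ t x)
      (hasFDerivAt_prodMk_right t (Φ t x))
    have h' : HasFDerivAt (fun y => g (t, y)) _ (Φ t x) := this
    rw [h'.fderiv]
    simp
  have hmixed : ∀ b : ι, fderiv ℝ (fun p => fderiv ℝ Ψ p ((0 : κ → ℂ), Pi.single b (1 : ℝ)))
      (t, x) (v, 0) = fderiv ℝ (fun z => fderiv ℝ Ψ (t, z) (v, 0)) x (Pi.single b 1) := by
    intro b
    rw [(e2 b).fderiv]
    have h := (hΨ2.hasFDerivAt.clm_apply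
      (hasFDerivAt_const (v, (0 : ι → ℝ)) (t, x))).comp x (hasFDerivAt_prodMk_right t x)
    have h' : HasFDerivAt (fun z => fderiv ℝ Ψ (t, z) (v, 0)) _ x := h
    rw [h'.fderiv]
    simpa using (hΨ.isSymmSndFDerivAt (by
      rw [minSmoothness_of_isRCLikeNormedField]
      exact WithTop.coe_le_coe.2 le_top)).eq (v, 0) (0, Pi.single b 1)
  rw [hcongr.fderiv_eq, (e1.fun_mul d1.hasFDerivAt).fderiv]
  simp only [add_apply, smul_apply, d2, smul_eq_mul, hjac, hmixed, hslice]
  have hsplit : ((((fderiv ℂ g (t, Φ t x)).restrictScalars ℝ).comp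
      ((ContinuousLinearMap.fst ℝ _ _).prod (fderiv ℝ Ψ (t, x)))) (v, 0) : ℂ) =
      fderiv ℂ g (t, Φ t x) (v, 0) + fderiv ℂ g (t, Φ t x) (0, fderiv ℝ Ψ (t, x) (v, 0)) := by
    rw [← map_add]
    simp
  rw [hsplit]
  simp only [hΨdef, Function.uncurry_apply_pair]
  ring

end Pointwise

/-- The integral of a holomorphic family of top forms over a smooth family of cells is holomorphic
and can be differentiated under the integral sign as if the cells did not move. The family of
cells is only smooth in the real sense: the real derivative of the truncated integral differs
from the integral of the derivative by boundary terms, which tend to zero uniformly in `t`. -/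
theorem hasFDerivAt_cellIntegral [DecidableEq κ] (hU : IsOpen U)
    (hΦ : ContDiffOn ℝ ∞ (Function.uncurry Φ) (U ×ˢ Set.univ))
    {g : (κ → ℂ) × (ι → ℂ) → ℂ} (hg : ContDiff ℂ 1 g) {t₁ : κ → ℂ} (ht₁ : t₁ ∈ U)
    {G : (ι → ℝ) → ℝ} (hG : Integrable G)
    (h0 : ∀ᶠ t in 𝓝 t₁, ∀ x, ‖g (t, Φ t x)‖ *
      (1 + ‖fderiv ℝ (Function.uncurry Φ) (t, x)‖) ^ Fintype.card ι ≤ G x)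
    (h1 : ∀ᶠ t in 𝓝 t₁, ∀ x v, ‖fderiv ℂ g (t, Φ t x) (v, 0)‖ *
      (1 + ‖fderiv ℝ (Function.uncurry Φ) (t, x)‖) ^ Fintype.card ι ≤ ‖v‖ * G x) :
    HasFDerivAt (cellIntegral g Φ)
      (∑ j, cellIntegral (fun p => fderiv ℂ g p (Pi.single j 1, 0)) Φ t₁ •
        ContinuousLinearMap.proj (R := ℂ) (φ := fun _ : κ => ℂ) j) t₁ := by
  obtain ⟨K, hK, χ, hχ⟩ := exists_cutoff (ι := ι)
  set Ψ := Function.uncurry Φ with hΨ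
  set D : (κ → ℂ) × (ι → ℝ) → ℂ := fun p =>
    g (p.1, Φ p.1 p.2) * rowDet ι (jacRows (Φ p.1) p.2) with hD
  have hDs : ContDiffOn ℝ 1 D (U ×ˢ Set.univ) := contDiffOn_familyDensity hU hΦ hg
  have hrow : ∀ t ∈ U, ∀ x b, ‖jacRows (Φ t) x b‖ ≤ 1 + ‖fderiv ℝ Ψ (t, x)‖ := by
    intro t ht x b
    refine ((fderiv ℝ (Φ t) x).le_opNorm _).trans ?_
    rw [Pi.norm_single, norm_one, mul_one]
    linarith [norm_fderiv_slice_le hU hΦ ht x]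
  have hgood : ∀ᶠ t in 𝓝 t₁, t ∈ U ∧ (∀ x, ‖g (t, Φ t x)‖ *
      (1 + ‖fderiv ℝ Ψ (t, x)‖) ^ Fintype.card ι ≤ G x) ∧
      ∀ x v, ‖fderiv ℂ g (t, Φ t x) (v, 0)‖ *
      (1 + ‖fderiv ℝ Ψ (t, x)‖) ^ Fintype.card ι ≤ ‖v‖ * G x :=
    (hU.eventually_mem ht₁).and (h0.and h1)
  set L : (κ → ℂ) → (κ → ℂ) →L[ℂ] ℂ := fun t =>
    ∑ j, cellIntegral (fun p => fderiv ℂ g p (Pi.single j 1, 0)) Φ t •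
        ContinuousLinearMap.proj (R := ℂ) (φ := fun _ : κ => ℂ) j with hL
  set F' : ℕ → (κ → ℂ) → (κ → ℂ) →L[ℝ] ℂ := fun m t =>
    ∫ x, χ m x • (fderiv ℝ D (t, x)).comp (ContinuousLinearMap.inl ℝ (κ → ℂ) (ι → ℝ)) with hF'
  have hcont : ∀ t ∈ U, ∀ v, Continuous fun x =>
      fderiv ℂ g (t, Φ t x) (v, 0) * rowDet ι (jacRows (Φ t) x) := fun t ht v =>
    ((((hg.continuous_fderiv (by simp)).comp
      (continuous_const.prodMk (contDiff_slice hU hΦ ht).continuous))).clm_apply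
        continuous_const).mul ((rowDet ι).cont.comp (contDiff_jacRows
          ((contDiff_slice hU hΦ ht).of_le (WithTop.coe_le_coe.2 le_top))).continuous)
  have hbd : ∀ t, t ∈ U → (∀ x v, ‖fderiv ℂ g (t, Φ t x) (v, 0)‖ *
      (1 + ‖fderiv ℝ Ψ (t, x)‖) ^ Fintype.card ι ≤ ‖v‖ * G x) → ∀ x v,
      ‖fderiv ℂ g (t, Φ t x) (v, 0) * rowDet ι (jacRows (Φ t) x)‖ ≤
        ‖rowDet ι‖ * ‖v‖ * G x := by
    intro t ht h x v
    rw [norm_mul]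
    calc _ ≤ ‖fderiv ℂ g (t, Φ t x) (v, 0)‖ *
          (‖rowDet ι‖ * (1 + ‖fderiv ℝ Ψ (t, x)‖) ^ Fintype.card ι) := by
          gcongr
          exact norm_rowDet_le (hrow t ht x)
      _ = ‖rowDet ι‖ * (‖fderiv ℂ g (t, Φ t x) (v, 0)‖ *
          (1 + ‖fderiv ℝ Ψ (t, x)‖) ^ Fintype.card ι) := by ring
      _ ≤ ‖rowDet ι‖ * (‖v‖ * G x) := mul_le_mul_of_nonneg_left (h x v) (norm_nonneg _)
      _ = _ := by ring
  -- the candidate derivative `L t`, evaluated on a general vector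
  have hLv : ∀ t, t ∈ U → (∀ x v, ‖fderiv ℂ g (t, Φ t x) (v, 0)‖ *
      (1 + ‖fderiv ℝ Ψ (t, x)‖) ^ Fintype.card ι ≤ ‖v‖ * G x) → ∀ v,
      L t v = ∫ x, fderiv ℂ g (t, Φ t x) (v, 0) * rowDet ι (jacRows (Φ t) x) := by
    intro t ht h v
    have hv : ∀ x, fderiv ℂ g (t, Φ t x) (v, 0) * rowDet ι (jacRows (Φ t) x) =
        ∑ j, v j * (fderiv ℂ g (t, Φ t x) (Pi.single j 1, 0) *
          rowDet ι (jacRows (Φ t) x)) := by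
      intro x
      have : ((v, 0) : (κ → ℂ) × (ι → ℂ)) = ∑ j, v j • ((Pi.single j 1, 0) :
          (κ → ℂ) × (ι → ℂ)) := by
        ext i
        · simp [Prod.fst_sum, Finset.sum_apply, Pi.single_apply]
        · simp [Prod.snd_sum]
      rw [this, map_sum, Finset.sum_mul]
      refine Finset.sum_congr rfl fun j _ => ?_
      rw [map_smul, smul_eq_mul, mul_assoc]
    simp_rw [hv]
    rw [integral_finsetSum]
    · simp only [hL, cellIntegral, integral_const_mul]
      simp [mul_comm]
    · intro j _
      refine Integrable.const_mul ((hG.const_mul _).mono' (hcont t ht _).aestronglyMeasurable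
        (Eventually.of_forall fun x => hbd t ht h x _)) _
  -- the derivatives `F' m` of the truncated integrals converge to `L` uniformly near `t₁`
  have hmain : ∀ m : ℕ, ∀ t, t ∈ U → (∀ x, ‖g (t, Φ t x)‖ *
      (1 + ‖fderiv ℝ Ψ (t, x)‖) ^ Fintype.card ι ≤ G x) →
      (∀ x v, ‖fderiv ℂ g (t, Φ t x) (v, 0)‖ *
      (1 + ‖fderiv ℝ Ψ (t, x)‖) ^ Fintype.card ι ≤ ‖v‖ * G x) →
      ‖F' m t - (L t).restrictScalars ℝ‖ ≤ ‖rowDet ι‖ * (1 + Fintype.card ι * K) *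
        ∫ x in (Metric.closedBall (0 : ι → ℝ) m)ᶜ, G x := by
    intro m t ht hb0 hb1
    have hG0 : ∀ x, 0 ≤ G x := fun x => le_trans (by positivity) (hb0 x)
    refine ContinuousLinearMap.opNorm_le_bound _
      (mul_nonneg (by positivity) (integral_nonneg hG0)) fun v => ?_
    set h : (ι → ℝ) → ℂ := fun x =>
      fderiv ℂ g (t, Φ t x) (v, 0) * rowDet ι (jacRows (Φ t) x) with hh
    set w : (ι → ℝ) → ι → ℂ := fun z => fderiv ℝ Ψ (t, z) (v, 0) with hw
    have hws : ContDiff ℝ 1 w := contDiff_iff_contDiffAt.2 fun x =>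
      (((contDiffAt_family hU hΦ ht x).fderiv_right (m := 1) (WithTop.coe_le_coe.2 le_top)).comp x
        (contDiffAt_const.prodMk contDiffAt_id)).clm_apply contDiffAt_const
    have hDc : Continuous fun x => fderiv ℝ D (t, x) := continuous_slice
      (hDs.continuousOn_fderiv_of_isOpen (hU.prod isOpen_univ) le_rfl) ht
    -- Stokes' theorem for the velocity field `w` of the family removes the terms by which the
    -- derivative of the density differs from `h`
    have hst := integral_cutoff_divergence (hχ m).smooth (hχ m).compact
      (φ := Φ t) (w := w) (g := fun y => g (t, y))
      ((contDiff_slice hU hΦ ht).of_le (WithTop.coe_le_coe.2 le_top)) hws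
      (hg.comp (contDiff_const.prodMk contDiff_id))
    have hbr : ∀ x, fderiv ℂ (fun y => g (t, y)) (Φ t x) (w x) * rowDet ι (jacRows (Φ t) x) +
        g (t, Φ t x) * ∑ b, rowDet ι (Function.update (jacRows (Φ t) x) b
          (fderiv ℝ w x (Pi.single b 1))) = fderiv ℝ D (t, x) (v, 0) - h x := by
      intro x
      rw [fderiv_familyDensity hU hΦ hg ht x v]
      exact (add_sub_cancel_left _ _).symm
    simp_rw [hbr, smul_sub] at hst
    have hχc := (hχ m).smooth.continuous
    have hi1 : Integrable fun x => χ m x • fderiv ℝ D (t, x) (v, 0) :=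
      (hχc.smul (hDc.clm_apply continuous_const)).integrable_of_hasCompactSupport
        (hχ m).compact.smul_right
    have hi2 : Integrable fun x => χ m x • h x :=
      (hχc.smul (hcont t ht v)).integrable_of_hasCompactSupport (hχ m).compact.smul_right
    rw [integral_sub hi1 hi2, sub_eq_iff_eq_add, neg_add_eq_sub] at hst
    have hFv : F' m t v = ∫ x, χ m x • fderiv ℝ D (t, x) (v, 0) := by
      rw [hF']
      simp only
      rw [ContinuousLinearMap.integral_apply]
      · simp
      · exact (hχc.smul (hDc.clm_comp continuous_const)).integrable_of_hasCompactSupport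
          (hχ m).compact.smul_right
    have hle := norm_cutoff_sub_le (hχ m) hG (h := h)
      (F := fun b x => g (t, Φ t x) * rowDet ι (Function.update (jacRows (Φ t) x) b (w x)))
      (c := ‖rowDet ι‖ * ‖v‖) (hcont t ht v) (hbd t ht hb1 · v) fun b x => ?_
    · rw [sub_apply, hFv, hst, ContinuousLinearMap.coe_restrictScalars', hLv t ht hb1]
      refine hle.trans_eq ?_
      ring
    · rw [norm_mul]
      calc _ ≤ ‖g (t, Φ t x)‖ *
            (‖rowDet ι‖ * (1 + ‖fderiv ℝ Ψ (t, x)‖) ^ Fintype.card ι * ‖v‖) := by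
            gcongr
            refine norm_rowDet_update_le (hrow t ht x) b ?_
            refine ((fderiv ℝ Ψ (t, x)).le_opNorm _).trans ?_
            have : ‖((v, 0) : (κ → ℂ) × (ι → ℝ))‖ = ‖v‖ := by simp [Prod.norm_def]
            rw [this]
            gcongr
            linarith
        _ = ‖rowDet ι‖ * ‖v‖ * (‖g (t, Φ t x)‖ *
            (1 + ‖fderiv ℝ Ψ (t, x)‖) ^ Fintype.card ι) := by ring
        _ ≤ _ := mul_le_mul_of_nonneg_left (hb0 x) (by positivity)
  have hlim := (tendsto_tail hG).const_mul (‖rowDet ι‖ * (1 + Fintype.card ι * K))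
  rw [mul_zero] at hlim
  have hreal : HasFDerivAt (cellIntegral g Φ) ((L t₁).restrictScalars ℝ) t₁ := by
    refine hasFDerivAt_of_tendstoUniformlyOnFilter (l := atTop)
      (f := fun m t => ∫ x, χ m x • D (t, x)) (f' := F')
      (g' := fun t => (L t).restrictScalars ℝ) ?_ ?_ ?_
    · rw [Metric.tendstoUniformlyOnFilter_iff]
      intro ε hε
      filter_upwards [((tendsto_order.1 hlim).2 ε hε).prod_mk hgood] with p hp
      rw [dist_comm, dist_eq_norm]
      exact (hmain p.1 p.2 hp.2.1 hp.2.2.1 hp.2.2.2).trans_lt hp.1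
    · filter_upwards [(Eventually.of_forall fun _ => trivial : ∀ᶠ _ : ℕ in atTop, True).prod_mk
        (hU.eventually_mem ht₁)] with p hp
      exact hasFDerivAt_integral_cutoff (hχ p.1).smooth.continuous (hχ p.1).compact hU hDs hp.2
    · filter_upwards [hgood] with t ht
      rw [tendsto_iff_norm_sub_tendsto_zero]
      refine squeeze_zero (fun _ => norm_nonneg _) (fun m => ?_) hlim
      have hle := norm_cutoff_sub_le (hχ m) hG (h := fun x => D (t, x)) (F := fun _ _ => 0)
        (c := ‖rowDet ι‖) (continuous_slice hDs.continuousOn ht.1) (fun x => ?_) fun b x => ?_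
      · simpa [cellIntegral, hD] using hle
      · rw [hD, norm_mul]
        calc _ ≤ ‖g (t, Φ t x)‖ *
              (‖rowDet ι‖ * (1 + ‖fderiv ℝ Ψ (t, x)‖) ^ Fintype.card ι) := by
              gcongr
              exact norm_rowDet_le (hrow t ht.1 x)
          _ = ‖rowDet ι‖ * (‖g (t, Φ t x)‖ *
              (1 + ‖fderiv ℝ Ψ (t, x)‖) ^ Fintype.card ι) := by ring
          _ ≤ _ := mul_le_mul_of_nonneg_left (ht.2.1 x) (norm_nonneg _)
      · rw [norm_zero]
        exact mul_nonneg (norm_nonneg _) (le_trans (by positivity) (ht.2.1 x))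
  -- the real derivative is complex linear, although the velocity of the cells is not
  exact hasFDerivAt_of_restrictScalars ℝ hreal rfl

end Family

/-! ### Continuants and tridiagonal determinants -/

section Continuant

/-- The continuant of the sequences `d` and `q`, by the three-term recursion
`K_{k+2} = K_{k+1} d_{k+1} + q_{k+1} K_k`. The factors are in the order that suits differential
operators: coefficients `q` to the left of derivatives `d`. -/
def continuant {S : Type*} [Ring S] (d q : ℕ → S) : ℕ → S
  | 0 => 1
  | 1 => d 0
  | k + 2 => continuant d q (k + 1) * d (k + 1) + q (k + 1) * continuant d q k

variable {S : Type*}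

theorem continuant_zero [Ring S] (d q : ℕ → S) : continuant d q 0 = 1 := by
  rw [continuant]

theorem continuant_one [Ring S] (d q : ℕ → S) : continuant d q 1 = d 0 := by
  rw [continuant]

theorem continuant_add_two [Ring S] (d q : ℕ → S) (k : ℕ) : continuant d q (k + 2) =
    continuant d q (k + 1) * d (k + 1) + q (k + 1) * continuant d q k := by
  rw [continuant]

/-- The tridiagonal matrix with diagonal `d`, superdiagonal `q` and subdiagonal `-1`. -/
def triMatrix [Ring S] (d q : ℕ → S) (m : ℕ) : Matrix (Fin m) (Fin m) S :=
  Matrix.of fun i j =>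
    if (i : ℕ) = j then d i else if (i : ℕ) + 1 = j then q j else if (j : ℕ) + 1 = i then -1 else 0

/-- Expansion along the last row: only its last two entries are nonzero, and the minor of the
entry `-1` is expanded along its last column. -/
theorem det_triMatrix [CommRing S] (d q : ℕ → S) : ∀ m, (triMatrix d q m).det = continuant d q m
  | 0 => by rw [Matrix.det_fin_zero, continuant_zero]
  | 1 => by rw [Matrix.det_fin_one, continuant_one]; simp [triMatrix]
  | m + 2 => by
    rw [continuant_add_two, ← det_triMatrix d q (m + 1), ← det_triMatrix d q m,
      Matrix.det_succ_row _ (Fin.last (m + 1)), Fin.sum_univ_castSucc, Fin.sum_univ_castSucc,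
      Finset.sum_eq_zero, zero_add]
    · have h1 : (triMatrix d q (m + 2)).submatrix (Fin.last (m + 1)).succAbove
          (Fin.last (m + 1)).succAbove = triMatrix d q (m + 1) := by
        ext i j
        simp [triMatrix]
      have h2 : ((triMatrix d q (m + 2)).submatrix (Fin.last (m + 1)).succAbove
          (Fin.last m).castSucc.succAbove).det = q (m + 1) * (triMatrix d q m).det := by
        rw [Matrix.det_succ_column _ (Fin.last m), Fin.sum_univ_castSucc, Finset.sum_eq_zero,
          zero_add]
        · have h3 : (((triMatrix d q (m + 2)).submatrix (Fin.last (m + 1)).succAbove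
              (Fin.last m).castSucc.succAbove).submatrix (Fin.last m).succAbove
              (Fin.last m).succAbove) = triMatrix d q m := by
            ext i j
            have : (Fin.last m).castSucc.succAbove j.castSucc = j.castSucc.castSucc := by
              rw [Fin.succAbove_of_castSucc_lt]
              exact Fin.castSucc_lt_castSucc_iff.2 (Fin.castSucc_lt_last j)
            simp [triMatrix, this]
          rw [h3]
          simp [triMatrix, ← two_mul]
        · intro i _
          have hi := i.2
          have : ((triMatrix d q (m + 2)).submatrix (Fin.last (m + 1)).succAbove
              (Fin.last m).castSucc.succAbove) i.castSucc (Fin.last m) = 0 := by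
            simp only [triMatrix, Matrix.submatrix_apply, Matrix.of_apply, Fin.succAbove_last,
              Fin.succAbove_castSucc_self, Fin.val_castSucc, Fin.succ_last, Fin.val_last]
            rw [if_neg (by omega), if_neg (by omega), if_neg (by omega)]
          rw [this]
          ring
      rw [h1, h2]
      simp only [triMatrix, Matrix.of_apply, Fin.val_last, Fin.val_castSucc, ← two_mul]
      simp
      ring_nf
      simp
    · intro j _
      have hj := j.2
      have : (triMatrix d q (m + 2)) (Fin.last (m + 1)) j.castSucc.castSucc = 0 := by
        simp only [triMatrix, Matrix.of_apply, Fin.val_last, Fin.val_castSucc]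
        rw [if_neg (by omega), if_neg (by omega), if_neg (by omega)]
      rw [this]
      ring

/-- Factoring a bidiagonal product in the two possible orders: the continuants of `y + X Y` and of
`y + Y X` for bidiagonal `X`, `Y` determine each other. -/
theorem continuant_factor [CommRing S] (y : S) (u v vp : ℕ → S) (h0 : vp 0 = 0)
    (hs : ∀ j, vp (j + 1) = v j) (q q' : ℕ → S) (hq : ∀ k, q (k + 1) = u k * v k)
    (hq' : ∀ k, q' (k + 1) = u (k + 1) * v k) (k : ℕ) :
    continuant (fun j => y - u j + vp j) q (k + 1) =
        y * continuant (fun j => y - u j + v j) q' k -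
          u k * continuant (fun j => y - u j + vp j) q k ∧
      continuant (fun j => y - u j + v j) q' (k + 1) =
        continuant (fun j => y - u j + vp j) q (k + 1) +
          v k * continuant (fun j => y - u j + v j) q' k := by
  induction k with
  | zero =>
    simp only [continuant_zero, continuant_one, h0, zero_add]
    constructor <;> ring
  | succ k ih =>
    obtain ⟨ih1, ih2⟩ := ih
    have e1 : continuant (fun j => y - u j + vp j) q (k + 1 + 1) =
        y * continuant (fun j => y - u j + v j) q' (k + 1) -
          u (k + 1) * continuant (fun j => y - u j + vp j) q (k + 1) := by
      rw [continuant_add_two, hq, hs]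
      linear_combination v k * ih1 - y * ih2
    refine ⟨e1, ?_⟩
    rw [e1, continuant_add_two, hq']
    linear_combination (-u (k + 1)) * ih2

/-- For an `(m + 1) × m` matrix `X` and an `m × (m + 1)` matrix `Y`, both bidiagonal, the identity
`det (y + X Y) = y det (y + Y X)` in terms of continuants. -/
theorem continuant_factor_of_eq_zero [CommRing S] (y : S) (u v vp : ℕ → S) (h0 : vp 0 = 0)
    (hs : ∀ j, vp (j + 1) = v j) (q q' : ℕ → S) (hq : ∀ k, q (k + 1) = u k * v k)
    (hq' : ∀ k, q' (k + 1) = u (k + 1) * v k) {m : ℕ} (hm : u m = 0) :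
    continuant (fun j => y - u j + vp j) q (m + 1) =
      y * continuant (fun j => y - u j + v j) q' m := by
  rw [(continuant_factor y u v vp h0 hs q q' hq hq' m).1, hm, zero_mul, sub_zero]

/-- Continuants whose coefficients `q` agree modulo an ideal agree modulo this ideal. -/
theorem continuant_sub_mem [CommRing S] (J : Ideal S) (d q q' : ℕ → S) :
    ∀ m, (∀ j, j + 1 < m → q (j + 1) - q' (j + 1) ∈ J) →
      continuant d q m - continuant d q' m ∈ J
  | 0, _ => by simp [continuant_zero]
  | 1, _ => by simp [continuant_one]
  | m + 2, h => by
    have h1 := continuant_sub_mem J d q q' (m + 1) fun j hj => h j (by omega)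
    have h2 := continuant_sub_mem J d q q' m fun j hj => h j (by omega)
    have h3 := h m (by omega)
    have : continuant d q (m + 2) - continuant d q' (m + 2) =
        d (m + 1) * (continuant d q (m + 1) - continuant d q' (m + 1)) +
        q (m + 1) * (continuant d q m - continuant d q' m) +
        continuant d q' m * (q (m + 1) - q' (m + 1)) := by
      rw [continuant_add_two, continuant_add_two]
      ring
    rw [this]
    exact J.add_mem (J.add_mem (J.mul_mem_left _ h1) (J.mul_mem_left _ h2)) (J.mul_mem_left _ h3)

end Continuant

/-! ### Continuants of first order differential operators -/

section OperatorContinuant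

variable {R : Type*} [CommRing R] [Algebra ℂ R]

/-- The continuant in the operators `x + ħ δ_j + h_j` and the multiplications by `q_k`. -/
def opContinuant (hbar x : ℂ) (δ : ℕ → Derivation ℂ R R) (h q : ℕ → R) (k : ℕ) :
    Module.End ℂ R :=
  continuant (fun j => algebraMap ℂ (Module.End ℂ R) x + hbar • (δ j : R →ₗ[ℂ] R) +
    LinearMap.mulLeft ℂ (h j)) (fun j => LinearMap.mulLeft ℂ (q j)) k

variable (hbar x : ℂ) (δ : ℕ → Derivation ℂ R R) (h q : ℕ → R)

theorem opContinuant_zero (F : R) : opContinuant hbar x δ h q 0 F = F := by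
  rw [opContinuant, continuant_zero, Module.End.one_apply]

theorem opContinuant_one (F : R) :
    opContinuant hbar x δ h q 1 F = x • F + hbar • δ 0 F + h 0 * F := by
  rw [opContinuant, continuant_one]
  simp [Module.algebraMap_end_apply]

theorem opContinuant_add_two (k : ℕ) (F : R) : opContinuant hbar x δ h q (k + 2) F =
    opContinuant hbar x δ h q (k + 1) (x • F + hbar • δ (k + 1) F + h (k + 1) * F) +
      q (k + 1) * opContinuant hbar x δ h q k F := by
  rw [opContinuant, continuant_add_two]
  simp [Module.algebraMap_end_apply, opContinuant]

/-- An operator continuant acts by multiplication on functions that are constant for all the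
derivations involved: no derivation hits a coefficient. -/
theorem opContinuant_apply_of_forall_eq_zero (hh : ∀ j k, j < k → δ j (h k) = 0) :
    ∀ k F, (∀ j, j < k → δ j F = 0) → opContinuant hbar x δ h q k F =
      continuant (fun j => algebraMap ℂ R x + h j) q k * F
  | 0, F, _ => by rw [opContinuant_zero, continuant_zero, one_mul]
  | 1, F, hF => by
    rw [opContinuant_one, continuant_one, hF 0 one_pos, Algebra.smul_def]
    simp
    ring
  | k + 2, F, hF => by
    rw [opContinuant_add_two, continuant_add_two,
      opContinuant_apply_of_forall_eq_zero hh k F fun j hj => hF j (by omega),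
      opContinuant_apply_of_forall_eq_zero hh (k + 1), hF (k + 1) (by omega),
      Algebra.smul_def x F]
    · simp
      ring
    · intro j hj
      rw [hF (k + 1) (by omega)]
      simp [hF j (by omega), hh j (k + 1) hj]

theorem opContinuant_mul_of_forall_eq_zero (r : R) :
    ∀ k F, (∀ j, j < k → δ j r = 0) → opContinuant hbar x δ h q k (r * F) =
      r * opContinuant hbar x δ h q k F
  | 0, F, _ => by rw [opContinuant_zero, opContinuant_zero]
  | 1, F, hr => by
    simp only [opContinuant_one, Derivation.leibniz, hr 0 one_pos, Algebra.smul_def,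
      Algebra.algebraMap_self, RingHom.id_apply]
    ring
  | k + 2, F, hr => by
    have e : x • (r * F) + hbar • δ (k + 1) (r * F) + h (k + 1) * (r * F) =
        r * (x • F + hbar • δ (k + 1) F + h (k + 1) * F) := by
      simp only [Derivation.leibniz, hr (k + 1) (by omega), Algebra.smul_def,
        Algebra.algebraMap_self, RingHom.id_apply]
      ring
    rw [opContinuant_add_two, opContinuant_add_two, e,
      opContinuant_mul_of_forall_eq_zero r k F fun j hj => hr j (by omega),
      opContinuant_mul_of_forall_eq_zero r (k + 1) _ fun j hj => hr j (by omega)]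
    ring

theorem derivation_continuant_eq_zero (D : Derivation ℂ R R) (d : ℕ → R) :
    ∀ k, (∀ j, j < k → D (d j) = 0) → (∀ j, j < k → D (q j) = 0) → D (continuant d q k) = 0
  | 0, _, _ => by simp [continuant_zero]
  | 1, hd, _ => by rw [continuant_one, hd 0 one_pos]
  | k + 2, hd, hq => by
    rw [continuant_add_two, map_add, Derivation.leibniz, Derivation.leibniz,
      derivation_continuant_eq_zero D d k (fun j hj => hd j (by omega))
        (fun j hj => hq j (by omega)),
      derivation_continuant_eq_zero D d (k + 1) (fun j hj => hd j (by omega))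
        (fun j hj => hq j (by omega)), hd (k + 1) (by omega), hq (k + 1) (by omega)]
    simp

/-- Partial integration: modulo the ranges of the twisted derivatives `ħ δ_j + g_j + h_j`, the
multiplications by `-g_j` in a continuant can be replaced by the operators `ħ δ_j + h_j`. -/
theorem continuant_mul_sub_opContinuant_mem (g : ℕ → R) (N : Submodule ℂ R) {m : ℕ}
    (hN : ∀ j < m, ∀ P, hbar • δ j P + (g j + h j) * P ∈ N)
    (hg : ∀ j k, j < k → k < m → δ k (g j) = 0) (hq : ∀ j k, j < k → k < m → δ k (q j) = 0)
    (hq' : ∀ j k, j + 1 < k → k < m → δ j (q k) = 0) :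
    ∀ k ≤ m, ∀ F, continuant (fun j => algebraMap ℂ R x - g j) q k * F -
      opContinuant hbar x δ h q k F ∈ N
  | 0, _, F => by simp [continuant_zero, opContinuant_zero]
  | 1, hk, F => by
    rw [continuant_one, opContinuant_one]
    have := N.neg_mem (hN 0 (by omega) F)
    convert this using 1
    rw [Algebra.smul_def x F]
    ring
  | k + 2, hk, F => by
    set c := continuant (fun j => algebraMap ℂ R x - g j) q with hc
    have i1 := continuant_mul_sub_opContinuant_mem g N hN hg hq hq' (k + 1) (by omega)
      (x • F + hbar • δ (k + 1) F + h (k + 1) * F)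
    have i2 := continuant_mul_sub_opContinuant_mem g N hN hg hq hq' k (by omega) (q (k + 1) * F)
    rw [opContinuant_mul_of_forall_eq_zero _ _ _ _ _ _ _ _
      fun j hj => hq' j (k + 1) (by omega) (by omega)] at i2
    have i3 := N.neg_mem (hN (k + 1) (by omega) (c (k + 1) * F))
    have hδ : δ (k + 1) (c (k + 1)) = 0 := derivation_continuant_eq_zero _ _ _ _
      (fun j hj => by simp [hg j (k + 1) hj (by omega)])
      (fun j hj => hq j (k + 1) hj (by omega))
    rw [Derivation.leibniz, hδ, smul_zero, add_zero, smul_eq_mul] at i3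
    have := N.add_mem (N.add_mem i1 i2) i3
    convert this using 1
    rw [hc, continuant_add_two, opContinuant_add_two, Algebra.smul_def x F,
      Algebra.smul_def hbar, Algebra.smul_def hbar]
    ring

end OperatorContinuant

/-! ### The ring of edge variables and its twisted derivations -/

section EdgeRing

/-- Polynomials in the edge variables `u_e` (the variables `Sum.inl e`) and `v_e` (the variables
`Sum.inr e`), without the relations of the torus `Y_q`. -/
abbrev EdgeRing (n : ℕ) : Type := MvPolynomial (Vtx n ⊕ Vtx n) ℂ

/-- The space of all the variables `T_{ij}`, split into the parameters `t_j = T_{0j}` and the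
coordinates `T_{ij}`, `i > 0`. -/
abbrev VertexSpace (n : ℕ) : Type := (Fin (n + 1) → ℂ) × (Vtx n → ℂ)

variable {n : ℕ}

/-- The logarithms of the edge variables, which are linear functions on the vertex space. -/
def edgeLog (z : VertexSpace n) : Vtx n ⊕ Vtx n → ℂ := Sum.elim (logU z.1 z.2) (logV z.1 z.2)

/-- The derivative of polynomials in the edge variables in the direction `d`. -/
def edgeDer (d : VertexSpace n) : Derivation ℂ (EdgeRing n) (EdgeRing n) :=
  MvPolynomial.mkDerivation ℂ fun e => edgeLog d e • MvPolynomial.X e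

/-- The sum of all edge variables. -/
def edgeSum (n : ℕ) : EdgeRing n :=
  ∑ e, (MvPolynomial.X (Sum.inl e) + MvPolynomial.X (Sum.inr e))

/-- The linear part of the phase function. -/
def linPart (lam : Fin (n + 1) → ℂ) (d : VertexSpace n) : ℂ :=
  ∑ e, (weightU lam e * logU d.1 d.2 e + weightV lam e * logV d.1 d.2 e)

/-- The twisted derivation `e ^ (-f / ħ) ∘ ħ ∂_d ∘ e ^ (f / ħ)`, where `f` is the phase. -/
def twistedDer (lam : Fin (n + 1) → ℂ) (hbar : ℂ) (d : VertexSpace n) :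
    Module.End ℂ (EdgeRing n) :=
  hbar • (edgeDer d : EdgeRing n →ₗ[ℂ] EdgeRing n) +
    LinearMap.mulLeft ℂ (edgeDer d (edgeSum n) + MvPolynomial.C (linPart lam d))

theorem twistedDer_apply (lam : Fin (n + 1) → ℂ) (hbar : ℂ) (d : VertexSpace n)
    (P : EdgeRing n) : twistedDer lam hbar d P =
      hbar • edgeDer d P + (edgeDer d (edgeSum n) + MvPolynomial.C (linPart lam d)) * P := rfl

theorem edgeDer_X (d : VertexSpace n) (e : Vtx n ⊕ Vtx n) :
    edgeDer d (MvPolynomial.X e) = edgeLog d e • MvPolynomial.X e :=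
  MvPolynomial.mkDerivation_X _ _ _

theorem edgeDer_comm (d d' : VertexSpace n) (P : EdgeRing n) :
    edgeDer d (edgeDer d' P) = edgeDer d' (edgeDer d P) := by
  have h : ⁅edgeDer d, edgeDer d'⁆ = 0 := by
    apply MvPolynomial.derivation_ext
    intro e
    simp [Derivation.commutator_apply, edgeDer_X, smul_smul, mul_comm]
  have h' := congrArg (fun D : Derivation ℂ (EdgeRing n) (EdgeRing n) => D P) h
  simpa [Derivation.commutator_apply, sub_eq_zero] using h'

/-- The twisted derivations commute because mixed derivatives of the phase are symmetric. -/
theorem twistedDer_comm (lam : Fin (n + 1) → ℂ) (hbar : ℂ) (d d' : VertexSpace n) :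
    Commute (twistedDer lam hbar d) (twistedDer lam hbar d') := by
  refine LinearMap.ext fun P => ?_
  simp only [Module.End.mul_apply, twistedDer_apply, map_add, Derivation.leibniz,
    Derivation.map_smul, smul_eq_mul]
  rw [edgeDer_comm d' d P, edgeDer_comm d' d (edgeSum n)]
  simp only [MvPolynomial.smul_eq_C_mul, ← MvPolynomial.algebraMap_eq,
    Derivation.map_algebraMap]
  ring

/-- The direction of the variable `T_{ij}`. -/
def vdir (n i j : ℕ) : VertexSpace n :=
  (fun k => if i = 0 ∧ (k : ℕ) = j then 1 else 0,
    fun e => if (e.1.1 : ℕ) = i ∧ (e.1.2 : ℕ) = j then 1 else 0)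

theorem volt_vdir {i j k l : ℕ} (h : k + l ≤ n) :
    volt (vdir n i j).1 (vdir n i j).2 k l = if k = i ∧ l = j then 1 else 0 := by
  unfold volt vdir
  rcases Nat.eq_zero_or_pos k with rfl | hk
  · rw [dif_neg (by omega), dif_pos ⟨rfl, by omega⟩]
    simp [eq_comm]
  · rw [dif_pos ⟨hk, h⟩]
    rfl

/-- The variable `u_{ij}` (`0` outside of the graph). -/
def eu (n i j : ℕ) : EdgeRing n :=
  if h : 1 ≤ i ∧ i + j ≤ n then MvPolynomial.X (Sum.inl (vtx i j h)) else 0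

/-- The variable `v_{ij}` (`0` outside of the graph). -/
def ev (n i j : ℕ) : EdgeRing n :=
  if h : 1 ≤ i ∧ i + j ≤ n then MvPolynomial.X (Sum.inr (vtx i j h)) else 0

/-- The variable `v_{i,j-1}` (`0` for `j = 0`). -/
def evPrev (n i : ℕ) : ℕ → EdgeRing n
  | 0 => 0
  | j + 1 => ev n i j

theorem edgeDer_eu (i j k l : ℕ) : edgeDer (vdir n i j) (eu n (k + 1) l) =
    (((if k + 1 = i ∧ l = j then 1 else 0) - (if k = i ∧ l = j then 1 else 0) : ℂ)) •
      eu n (k + 1) l := by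
  by_cases h : 1 ≤ k + 1 ∧ k + 1 + l ≤ n
  · rw [eu, dif_pos h, edgeDer_X]
    congr 1
    simp only [edgeLog, Sum.elim_inl, logU, vtx, Nat.add_sub_cancel]
    rw [volt_vdir (by omega), volt_vdir (by omega)]
  · rw [eu, dif_neg h, map_zero, smul_zero]

theorem edgeDer_ev (i j k l : ℕ) : edgeDer (vdir n i j) (ev n (k + 1) l) =
    (((if k = i ∧ l + 1 = j then 1 else 0) - (if k + 1 = i ∧ l = j then 1 else 0) : ℂ)) •
      ev n (k + 1) l := by
  by_cases h : 1 ≤ k + 1 ∧ k + 1 + l ≤ n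
  · rw [ev, dif_pos h, edgeDer_X]
    congr 1
    simp only [edgeLog, Sum.elim_inr, logV, vtx, Nat.add_sub_cancel]
    rw [volt_vdir (by omega), volt_vdir (by omega)]
  · rw [ev, dif_neg h, map_zero, smul_zero]

theorem sum_vtx_ite {M : Type*} [AddCommMonoid M] (k l : ℕ) (f : Vtx n → M) :
    (∑ e : Vtx n, if (e.1.1 : ℕ) = k ∧ (e.1.2 : ℕ) = l then f e else 0) =
      if h : 1 ≤ k ∧ k + l ≤ n then f (vtx k l h) else 0 := by
  split_ifs with h
  · rw [Finset.sum_eq_single (vtx k l h)]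
    · simp [vtx]
    · rintro ⟨⟨a, b⟩, hab⟩ _ hne
      rw [if_neg]
      rintro ⟨h1, h2⟩
      apply hne
      simp only at h1 h2
      simp [vtx, ← h1, ← h2]
    · simp
  · refine Finset.sum_eq_zero fun e _ => if_neg ?_
    rintro ⟨rfl, rfl⟩
    exact h e.2

theorem logU_vdir (i j : ℕ) (e : Vtx n) : logU (vdir n i j).1 (vdir n i j).2 e =
    (if (e.1.1 : ℕ) = i ∧ (e.1.2 : ℕ) = j then 1 else 0) -
      (if (e.1.1 : ℕ) = i + 1 ∧ (e.1.2 : ℕ) = j then 1 else 0) := by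
  have he := e.2
  rw [logU, volt_vdir he.2, volt_vdir (by omega)]
  congr 1
  simp only [show ((e.1.1 : ℕ) - 1 = i ↔ (e.1.1 : ℕ) = i + 1) by omega]

theorem logV_vdir (i j : ℕ) (e : Vtx n) : logV (vdir n i j).1 (vdir n i j).2 e =
    (if (e.1.1 : ℕ) = i + 1 ∧ (e.1.2 : ℕ) + 1 = j then 1 else 0) -
      (if (e.1.1 : ℕ) = i ∧ (e.1.2 : ℕ) = j then 1 else 0) := by
  have he := e.2
  rw [logV, volt_vdir he.2, volt_vdir (by omega)]
  congr 1
  simp only [show ((e.1.1 : ℕ) - 1 = i ↔ (e.1.1 : ℕ) = i + 1) by omega]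

/-- The weights `λ_i` indexed by natural numbers. -/
def lamNat (lam : Fin (n + 1) → ℂ) (i : ℕ) : ℂ := if h : i < n + 1 then lam ⟨i, h⟩ else 0

/-- The part of `∂f / ∂T_{ij}` that comes from the edges between the layers `i - 1` and `i`. -/
def upperPart (lam : Fin (n + 1) → ℂ) (i j : ℕ) : EdgeRing n :=
  eu n i j - ev n i j + MvPolynomial.C (lamNat lam (i - 1))

/-- The part of `∂f / ∂T_{ij}` that comes from the edges between the layers `i` and `i + 1`. -/
def lowerPart (lam : Fin (n + 1) → ℂ) (i j : ℕ) : EdgeRing n :=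
  evPrev n (i + 1) j - eu n (i + 1) j - MvPolynomial.C (lamNat lam i)

theorem edgeDer_edgeSum (i j : ℕ) : edgeDer (vdir n i j) (edgeSum n) =
    eu n i j - ev n i j + (evPrev n (i + 1) j - eu n (i + 1) j) := by
  have h1 : ∀ e : Vtx n, edgeDer (vdir n i j)
      (MvPolynomial.X (Sum.inl e) + MvPolynomial.X (Sum.inr e)) =
      ((if (e.1.1 : ℕ) = i ∧ (e.1.2 : ℕ) = j then MvPolynomial.X (Sum.inl e) else 0) -
      (if (e.1.1 : ℕ) = i + 1 ∧ (e.1.2 : ℕ) = j then MvPolynomial.X (Sum.inl e) else 0)) +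
      ((if (e.1.1 : ℕ) = i + 1 ∧ (e.1.2 : ℕ) + 1 = j then MvPolynomial.X (Sum.inr e) else 0) -
      (if (e.1.1 : ℕ) = i ∧ (e.1.2 : ℕ) = j then MvPolynomial.X (Sum.inr e) else 0)) := by
    intro e
    rw [map_add, edgeDer_X, edgeDer_X, edgeLog, Sum.elim_inl, Sum.elim_inr, logU_vdir, logV_vdir,
      sub_smul, sub_smul]
    simp only [ite_smul, one_smul, zero_smul]
  rw [edgeSum, map_sum, Finset.sum_congr rfl fun e _ => h1 e]
  simp only [Finset.sum_add_distrib, Finset.sum_sub_distrib, sum_vtx_ite]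
  have h2 : (∑ e : Vtx n, if (e.1.1 : ℕ) = i + 1 ∧ (e.1.2 : ℕ) + 1 = j then
      (MvPolynomial.X (Sum.inr e) : EdgeRing n) else 0) = evPrev n (i + 1) j := by
    cases j with
    | zero => simp [evPrev]
    | succ j =>
      simp only [Nat.add_right_cancel_iff, sum_vtx_ite]
      rfl
  rw [h2]
  simp only [eu, ev]
  ring

theorem outerWeight_vtx (lam : Fin (n + 1) → ℂ) (k l : ℕ) (h : 1 ≤ k + 1 ∧ k + 1 + l ≤ n) :
    outerWeight lam (vtx (k + 1) l h) =
      lamNat lam k + 1 / 2 * ∑ a ∈ Finset.range k, lamNat lam a := by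
  have h1 : ∑ a ∈ Finset.range k, lamNat lam a =
      ∑ a ∈ Finset.range (n + 1), if a < k then lamNat lam a else 0 := by
    rw [← Finset.sum_filter]
    refine Finset.sum_congr ?_ fun _ _ => rfl
    ext a
    simp only [Finset.mem_range, Finset.mem_filter]
    omega
  rw [h1, Finset.sum_range]
  simp only [outerWeight, vtx, Nat.add_sub_cancel, Nat.add_lt_add_iff_right, lamNat]
  rw [dif_pos (by omega)]
  simp only [Fin.is_lt, dif_pos, Fin.eta]

theorem sum_range_lamNat (lam : Fin (n + 1) → ℂ) :
    ∑ a ∈ Finset.range (n + 1), lamNat lam a = ∑ i, lam i := by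
  rw [Finset.sum_range]
  simp only [lamNat, Fin.is_lt, dif_pos, Fin.eta]

theorem weightU_vtx (lam : Fin (n + 1) → ℂ) (k l : ℕ) (h : 1 ≤ k + 1 ∧ k + 1 + l ≤ n) :
    weightU lam (vtx (k + 1) l h) = if l = 0 then
      lamNat lam k + 1 / 2 * ∑ a ∈ Finset.range k, lamNat lam a else 1 / 2 * lamNat lam k := by
  rw [weightU, outerWeight_vtx]
  simp only [vtx, Nat.add_sub_cancel, lamNat]
  rw [dif_pos (by omega : k < n + 1)]

theorem weightV_vtx (lam : Fin (n + 1) → ℂ) (k l : ℕ) (h : 1 ≤ k + 1 ∧ k + 1 + l ≤ n) :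
    weightV lam (vtx (k + 1) l h) = if k + 1 + l = n then
      -(lamNat lam k + 1 / 2 * ∑ a ∈ Finset.range k, lamNat lam a)
      else -(1 / 2) * lamNat lam k := by
  rw [weightV, outerWeight_vtx]
  simp only [vtx, Nat.add_sub_cancel, lamNat]
  rw [dif_pos (by omega : k < n + 1)]

/-- The weights of the edges around `T_{ij}` add up to `λ_{i-1} - λ_i`. At the last vertex
`i = n` this uses `∑ λ_i = 0`. -/
theorem linPart_vdir (lam : Fin (n + 1) → ℂ) (hlam : ∑ i, lam i = 0) {i j : ℕ} (h : i + j ≤ n) :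
    linPart lam (vdir n i j) = (if i = 0 then 0 else lamNat lam (i - 1)) - lamNat lam i := by
  have h1 : linPart lam (vdir n i j) =
      ((∑ e : Vtx n, if (e.1.1 : ℕ) = i ∧ (e.1.2 : ℕ) = j then weightU lam e else 0) -
      ∑ e : Vtx n, if (e.1.1 : ℕ) = i + 1 ∧ (e.1.2 : ℕ) = j then weightU lam e else 0) +
      ((∑ e : Vtx n, if (e.1.1 : ℕ) = i + 1 ∧ (e.1.2 : ℕ) + 1 = j then weightV lam e else 0) -
      ∑ e : Vtx n, if (e.1.1 : ℕ) = i ∧ (e.1.2 : ℕ) = j then weightV lam e else 0) := by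
    simp only [linPart, logU_vdir, logV_vdir, mul_sub, mul_ite, mul_one, mul_zero,
      Finset.sum_add_distrib, Finset.sum_sub_distrib]
  have h2 : (∑ e : Vtx n, if (e.1.1 : ℕ) = i + 1 ∧ (e.1.2 : ℕ) + 1 = j then weightV lam e
      else 0) = if j = 0 then 0 else if i + j = n then
      -(lamNat lam i + 1 / 2 * ∑ a ∈ Finset.range i, lamNat lam a)
      else -(1 / 2) * lamNat lam i := by
    cases j with
    | zero => simp
    | succ j =>
      simp only [Nat.add_right_cancel_iff, sum_vtx_ite]
      rw [dif_pos (by omega), weightV_vtx, if_neg (Nat.succ_ne_zero j)]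
      simp only [show i + 1 + j = n ↔ i + (j + 1) = n by omega]
  have h3 : (∑ e : Vtx n, if (e.1.1 : ℕ) = i + 1 ∧ (e.1.2 : ℕ) = j then weightU lam e else 0) =
      if i + j = n then 0 else if j = 0 then
      lamNat lam i + 1 / 2 * ∑ a ∈ Finset.range i, lamNat lam a else 1 / 2 * lamNat lam i := by
    rw [sum_vtx_ite]
    by_cases hn : i + j = n
    · rw [dif_neg (by omega), if_pos hn]
    · rw [dif_pos (by omega), weightU_vtx, if_neg hn]
  have hsum := sum_range_lamNat lam
  rw [hlam] at hsum
  rw [h1, h2, h3, sum_vtx_ite, sum_vtx_ite]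
  rcases Nat.eq_zero_or_pos i with rfl | hi
  · rw [dif_neg (by omega), dif_neg (by omega)]
    by_cases hj : j = 0 <;> by_cases hn : 0 + j = n <;>
      simp only [hj, hn, if_true, if_false, Finset.range_zero, Finset.sum_empty]
    · have : n = 0 := by omega
      subst this
      simp at hsum
      simp [hsum]
    · have : ¬ 0 + 0 = n := by omega
      simp [this]
    · ring
    · ring
  · obtain ⟨k, rfl⟩ : ∃ k, i = k + 1 := ⟨i - 1, by omega⟩
    rw [dif_pos (by omega), dif_pos (by omega), weightU_vtx, weightV_vtx, Nat.add_sub_cancel,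
      if_neg (Nat.succ_ne_zero k), Finset.sum_range_succ]
    by_cases hj : j = 0 <;> by_cases hn : k + 1 + j = n <;>
      simp only [hj, hn, if_true, if_false]
    · obtain rfl : n = k + 1 := by omega
      rw [Finset.sum_range_succ, Finset.sum_range_succ] at hsum
      simp only [Nat.add_zero, if_true]
      linear_combination hsum
    · have hk : ¬ k + 1 + 0 = n := by omega
      simp only [hk, if_false]
      ring
    · ring
    · ring

theorem twistedDer_vdir_zero (lam : Fin (n + 1) → ℂ) (hlam : ∑ i, lam i = 0) (hbar : ℂ) {j : ℕ}
    (h : j ≤ n) (P : EdgeRing n) : twistedDer lam hbar (vdir n 0 j) P =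
      hbar • edgeDer (vdir n 0 j) P + lowerPart lam 0 j * P := by
  rw [twistedDer_apply, linPart_vdir lam hlam (by omega), edgeDer_edgeSum, lowerPart]
  have e1 : eu n 0 j = 0 := dif_neg (by omega)
  have e2 : ev n 0 j = 0 := dif_neg (by omega)
  rw [e1, e2, if_pos rfl, map_sub, map_zero]
  ring

theorem twistedDer_vdir_succ (lam : Fin (n + 1) → ℂ) (hlam : ∑ i, lam i = 0) (hbar : ℂ) {i j : ℕ}
    (h : i + 1 + j ≤ n) (P : EdgeRing n) : twistedDer lam hbar (vdir n (i + 1) j) P =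
      hbar • edgeDer (vdir n (i + 1) j) P +
        (upperPart lam (i + 1) j + lowerPart lam (i + 1) j) * P := by
  rw [twistedDer_apply, linPart_vdir lam hlam (by omega), edgeDer_edgeSum, lowerPart, upperPart,
    if_neg (Nat.succ_ne_zero i), map_sub]
  ring

/-- The ideal generated by the box relations `v_{ij} u_{i,j+1} = u_{i+1,j} v_{i+1,j}`. -/
def boxIdeal (n : ℕ) : Ideal (EdgeRing n) :=
  Ideal.span {P | ∃ i j, 1 ≤ i ∧ i + j + 1 ≤ n ∧
    P = ev n i j * eu n i (j + 1) - eu n (i + 1) j * ev n (i + 1) j}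

/-- `e ^ (T_{i,k} - T_{i,k-1})` as the product of the edges `u_{i+1,k-1}` and `v_{i+1,k-1}`, which
lie between the layers `i` and `i + 1` (`0` for `k = 0`, where there is no such variable). -/
def roof (n i : ℕ) : ℕ → EdgeRing n
  | 0 => 0
  | k + 1 => eu n (i + 1) k * ev n (i + 1) k

/-- `e ^ (T_{i,k} - T_{i,k-1})` as the product of the edges `v_{i,k-1}` and `u_{i,k}`, which lie
between the layers `i - 1` and `i`; by the box relation it is the same function as `roof n i k`. -/
def valley (n i : ℕ) : ℕ → EdgeRing n
  | 0 => 0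
  | k + 1 => eu n i (k + 1) * ev n i k

/-- Different vertices of a layer are not joined by an edge. -/
theorem edgeDer_lowerPart (lam : Fin (n + 1) → ℂ) (i : ℕ) {j k : ℕ} (h : j ≠ k) :
    edgeDer (vdir n i j) (lowerPart lam i k) = 0 := by
  have e1 : edgeDer (vdir n i j) (eu n (i + 1) k) = 0 := by
    rw [edgeDer_eu, if_neg (by omega), if_neg (by omega)]
    simp
  have e2 : edgeDer (vdir n i j) (evPrev n (i + 1) k) = 0 := by
    cases k with
    | zero => simp [evPrev]
    | succ k =>
      rw [evPrev, edgeDer_ev, if_neg (by omega), if_neg (by omega)]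
      simp
  rw [lowerPart, map_sub, map_sub, e1, e2, ← MvPolynomial.algebraMap_eq,
    Derivation.map_algebraMap]
  simp

theorem edgeDer_upperPart (lam : Fin (n + 1) → ℂ) (i : ℕ) {j k : ℕ} (h : j ≠ k) :
    edgeDer (vdir n (i + 1) j) (upperPart lam (i + 1) k) = 0 := by
  have e1 : edgeDer (vdir n (i + 1) j) (eu n (i + 1) k) = 0 := by
    rw [edgeDer_eu, if_neg (by omega), if_neg (by omega)]
    simp
  have e2 : edgeDer (vdir n (i + 1) j) (ev n (i + 1) k) = 0 := by
    rw [edgeDer_ev, if_neg (by omega), if_neg (by omega)]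
    simp
  rw [upperPart, map_add, map_sub, e1, e2, ← MvPolynomial.algebraMap_eq,
    Derivation.map_algebraMap]
  simp

theorem edgeDer_roof (i : ℕ) {j k : ℕ} (h : j ≠ k) (h' : j + 1 ≠ k) :
    edgeDer (vdir n i j) (roof n i k) = 0 := by
  cases k with
  | zero => simp [roof]
  | succ k =>
    rw [roof, Derivation.leibniz, edgeDer_eu, edgeDer_ev, if_neg (by omega), if_neg (by omega),
      if_neg (by omega)]
    simp

/-- The continuant of the Toda operators of layer `i`, twisted by the edges below this layer. -/
def layerOp (lam : Fin (n + 1) → ℂ) (hbar x : ℂ) (i k : ℕ) : Module.End ℂ (EdgeRing n) :=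
  opContinuant hbar x (fun j => edgeDer (vdir n i j)) (lowerPart lam i) (roof n i) k

/-- The Toda operators intertwine consecutive layers: modulo exact terms and the box relations,
the characteristic operator of the first layer acts on `1` as `∏ (x - λ_i)`. -/
theorem layerOp_sub_mem (lam : Fin (n + 1) → ℂ) (hlam : ∑ i, lam i = 0) (hbar x : ℂ)
    (N : Submodule ℂ (EdgeRing n)) (hbox : ∀ P ∈ boxIdeal n, P ∈ N)
    (hN : ∀ i j, i + 1 + j ≤ n → ∀ P, twistedDer lam hbar (vdir n (i + 1) j) P ∈ N) :
    ∀ m i, i + m = n + 1 → layerOp lam hbar x i m 1 -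
      algebraMap ℂ _ (∏ l ∈ Finset.Ico i (n + 1), (x - lamNat lam l)) ∈ N := by
  intro m
  induction m with
  | zero =>
    intro i hi
    rw [layerOp, opContinuant_zero, Finset.Ico_eq_empty (by omega)]
    simp
  | succ m ih =>
    intro i hi
    -- no derivative hits a coefficient
    have e1 : layerOp lam hbar x i (m + 1) 1 =
        continuant (fun j => algebraMap ℂ (EdgeRing n) x + lowerPart lam i j) (roof n i)
          (m + 1) := by
      rw [layerOp, opContinuant_apply_of_forall_eq_zero _ _ _ _ _
        (fun j k hjk => edgeDer_lowerPart lam i hjk.ne) _ _ (fun j _ => by simp), mul_one]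
    -- the Toda determinant of layer `i` factors into `x - λ_i` and one of layer `i + 1`
    have e2 : continuant (fun j => algebraMap ℂ (EdgeRing n) x + lowerPart lam i j) (roof n i)
        (m + 1) = algebraMap ℂ (EdgeRing n) (x - lamNat lam i) *
        continuant (fun j => algebraMap ℂ (EdgeRing n) x - upperPart lam (i + 1) j)
          (valley n (i + 1)) m := by
      have := continuant_factor_of_eq_zero (algebraMap ℂ (EdgeRing n) (x - lamNat lam i))
        (eu n (i + 1)) (ev n (i + 1)) (evPrev n (i + 1)) rfl (fun _ => rfl) (roof n i)
        (valley n (i + 1)) (fun _ => rfl) (fun _ => rfl) (m := m)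
        (by rw [eu, dif_neg (by omega)])
      have f1 : (fun j => algebraMap ℂ (EdgeRing n) x + lowerPart lam i j) = fun j =>
          algebraMap ℂ (EdgeRing n) (x - lamNat lam i) - eu n (i + 1) j + evPrev n (i + 1) j := by
        funext j
        rw [lowerPart, map_sub, MvPolynomial.algebraMap_eq]
        ring
      have f2 : (fun j => algebraMap ℂ (EdgeRing n) x - upperPart lam (i + 1) j) = fun j =>
          algebraMap ℂ (EdgeRing n) (x - lamNat lam i) - eu n (i + 1) j + ev n (i + 1) j := by
        funext j
        rw [upperPart, map_sub, MvPolynomial.algebraMap_eq, Nat.add_sub_cancel]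
        ring
      rw [f1, f2]
      exact this
    -- the box relations bring the superdiagonal back to the form it has in layer `i + 1`
    have e3 : continuant (fun j => algebraMap ℂ (EdgeRing n) x - upperPart lam (i + 1) j)
          (valley n (i + 1)) m -
        continuant (fun j => algebraMap ℂ (EdgeRing n) x - upperPart lam (i + 1) j)
          (roof n (i + 1)) m ∈ N := by
      refine hbox _ (continuant_sub_mem _ _ _ _ _ fun j hj => Ideal.subset_span ?_)
      exact ⟨i + 1, j, by omega, by omega, by rw [valley, roof, mul_comm (eu n (i + 1) (j + 1))]⟩
    -- partial integration turns the multiplications into operators of layer `i + 1`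
    have e4 := continuant_mul_sub_opContinuant_mem hbar x
      (fun j => edgeDer (vdir n (i + 1) j)) (lowerPart lam (i + 1)) (roof n (i + 1))
      (upperPart lam (i + 1)) N (m := m)
      (fun j hj P => by
        rw [← twistedDer_vdir_succ lam hlam hbar (by omega)]
        exact hN i j (by omega) P)
      (fun j k hjk _ => edgeDer_upperPart lam i hjk.ne')
      (fun j k hjk _ => edgeDer_roof _ hjk.ne' (by omega))
      (fun j k hjk _ => edgeDer_roof _ (by omega) (by omega)) m le_rfl 1
    rw [mul_one] at e4
    have e5 := N.smul_mem (x - lamNat lam i) (N.add_mem (N.add_mem e3 e4) (ih (i + 1) (by omega)))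
    rw [sub_add_sub_cancel, layerOp, sub_add_sub_cancel, smul_sub, Algebra.smul_def,
      Algebra.smul_def, ← map_mul, ← Finset.prod_eq_prod_Ico_succ_bot (by omega)
        (fun l => x - lamNat lam l)] at e5
    rwa [e1, e2]

end EdgeRing

/-! ### The quantized Toda polynomials on the ring of edge variables -/

section Quantization

/-- Raising one exponent in an ordered product of powers of commuting elements. -/
theorem prod_map_pow_add_single {M I : Type*} [Monoid M] [DecidableEq I] (f : I → M)
    (hf : ∀ i j, Commute (f i) (f j)) (a : I → ℕ) (j : I) :
    ∀ l : List I, l.Nodup → (l.map fun i => f i ^ (a i + if i = j then 1 else 0)).prod =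
      if j ∈ l then (l.map fun i => f i ^ a i).prod * f j else (l.map fun i => f i ^ a i).prod
  | [], _ => by simp
  | i :: l, h => by
    have hl := List.nodup_cons.1 h
    rw [List.map_cons, List.prod_cons, prod_map_pow_add_single f hf a j l hl.2]
    by_cases hij : i = j
    · subst hij
      have hc : Commute (l.map fun k => f k ^ a k).prod (f i) :=
        Commute.list_prod_left _ _ fun y hy => by
          obtain ⟨k, -, rfl⟩ := List.mem_map.1 hy
          exact (hf k i).pow_left _
      simp only [if_true, if_neg hl.1, List.mem_cons, true_or, List.map_cons, List.prod_cons,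
        pow_succ, mul_assoc]
      rw [hc.eq]
    · have hji : ¬ j = i := fun h => hij h.symm
      by_cases hj : j ∈ l <;> simp [hij, hji, hj, mul_assoc]

variable {n : ℕ} (lam : Fin (n + 1) → ℂ) (hbar : ℂ)

/-- The monomial `∇_0 ^ a_0 ⋯ ∇_n ^ a_n` in the twisted derivations along the parameters. -/
def twistedMonomial (a : Fin (n + 1) → ℕ) : Module.End ℂ (EdgeRing n) :=
  ((List.finRange (n + 1)).map fun j : Fin (n + 1) =>
    twistedDer lam hbar (vdir n 0 j) ^ a j).prod

theorem twistedMonomial_zero : twistedMonomial lam hbar 0 = 1 := by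
  simp [twistedMonomial]

theorem twistedMonomial_add_single (a : Fin (n + 1) → ℕ) (j : Fin (n + 1)) :
    twistedMonomial lam hbar (fun i => a i + if i = j then 1 else 0) =
      twistedMonomial lam hbar a * twistedDer lam hbar (vdir n 0 j) := by
  rw [twistedMonomial, prod_map_pow_add_single (fun j : Fin (n + 1) =>
    twistedDer lam hbar (vdir n 0 j)) (fun _ _ => twistedDer_comm lam hbar _ _) a j _
    (List.nodup_finRange _), if_pos (List.mem_finRange j), twistedMonomial]

/-- The operator `q ^ m ∇ ^ m` attached to a monomial `m` in `p` and `q`. -/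
def monomialOp (m : (Fin (n + 1) ⊕ Fin n) →₀ ℕ) : Module.End ℂ (EdgeRing n) :=
  LinearMap.mulLeft ℂ (∏ k : Fin n, roof n 0 ((k : ℕ) + 1) ^ m (Sum.inr k)) *
    twistedMonomial lam hbar fun j => m (Sum.inl j)

/-- Substitution of `p_j = ∇_j` and `q_k = u v`, coefficients to the left. -/
def quantOp : MvPolynomial (Fin (n + 1) ⊕ Fin n) ℂ →ₗ[ℂ] Module.End ℂ (EdgeRing n) :=
  (MvPolynomial.basisMonomials (Fin (n + 1) ⊕ Fin n) ℂ).constr ℂ (monomialOp lam hbar)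

theorem quantOp_monomial (m : (Fin (n + 1) ⊕ Fin n) →₀ ℕ) (c : ℂ) :
    quantOp lam hbar (MvPolynomial.monomial m c) = c • monomialOp lam hbar m := by
  have h : MvPolynomial.monomial m c =
      c • MvPolynomial.basisMonomials (Fin (n + 1) ⊕ Fin n) ℂ m := by
    rw [MvPolynomial.coe_basisMonomials, MvPolynomial.smul_monomial, smul_eq_mul, mul_one]
  rw [h, map_smul, quantOp, Module.Basis.constr_basis]

theorem quantOp_one : quantOp lam hbar 1 = 1 := by
  rw [← MvPolynomial.C_1, ← MvPolynomial.monomial_zero', quantOp_monomial, one_smul, monomialOp]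
  have : (fun j => (0 : (Fin (n + 1) ⊕ Fin n) →₀ ℕ) (Sum.inl j)) = 0 := rfl
  rw [this, twistedMonomial_zero]
  simp
  rfl

/-- Multiplication by `p_j` becomes composition with `∇_j` on the right, since the `∇_j`
commute. -/
theorem quantOp_mul_X_inl (P : MvPolynomial (Fin (n + 1) ⊕ Fin n) ℂ) (j : Fin (n + 1)) :
    quantOp lam hbar (P * MvPolynomial.X (Sum.inl j)) =
      quantOp lam hbar P * twistedDer lam hbar (vdir n 0 j) := by
  induction P using MvPolynomial.induction_on' with
  | add P Q hP hQ => rw [add_mul, map_add, map_add, hP, hQ, add_mul]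
  | monomial m c =>
    rw [MvPolynomial.X, MvPolynomial.monomial_mul, mul_one, quantOp_monomial, quantOp_monomial,
      smul_mul_assoc, monomialOp, monomialOp, mul_assoc, ← twistedMonomial_add_single]
    congr 2
    · simp
    · congr 1
      funext i
      simp [Finsupp.single_apply, eq_comm]

theorem quantOp_X_inr_mul (P : MvPolynomial (Fin (n + 1) ⊕ Fin n) ℂ) (k : Fin n) :
    quantOp lam hbar (MvPolynomial.X (Sum.inr k) * P) =
      LinearMap.mulLeft ℂ (roof n 0 ((k : ℕ) + 1)) * quantOp lam hbar P := by
  induction P using MvPolynomial.induction_on' with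
  | add P Q hP hQ => rw [mul_add, map_add, map_add, hP, hQ, mul_add]
  | monomial m c =>
    rw [MvPolynomial.X, MvPolynomial.monomial_mul, one_mul, quantOp_monomial, quantOp_monomial,
      mul_smul_comm, monomialOp, monomialOp, ← mul_assoc]
    congr 2
    · rw [Module.End.mul_eq_comp, ← LinearMap.mulLeft_mul]
      congr 1
      simp only [Finsupp.add_apply, pow_add, Finset.prod_mul_distrib]
      congr 1
      rw [Finset.prod_eq_single k]
      · simp
      · intro i _ hi
        simp [hi.symm]
      · simp
    · congr 1
      funext i
      simp

/-- The diagonal of the Toda matrix, shifted by `x`. -/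
def todaDiag (n : ℕ) (x : ℂ) (j : ℕ) : MvPolynomial (Fin (n + 1) ⊕ Fin n) ℂ :=
  (if h : j < n + 1 then MvPolynomial.X (Sum.inl ⟨j, h⟩) else 0) + MvPolynomial.C x

/-- The superdiagonal of the Toda matrix: the variable `q_j`. -/
def todaSuper (n : ℕ) : ℕ → MvPolynomial (Fin (n + 1) ⊕ Fin n) ℂ
  | 0 => 0
  | j + 1 => if h : j < n then MvPolynomial.X (Sum.inr ⟨j, h⟩) else 0

theorem todaMatrix_add_scalar (n : ℕ) (x : ℂ) :
    todaMatrix n + Matrix.scalar (Fin (n + 1)) (MvPolynomial.C x) =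
      triMatrix (todaDiag n x) (todaSuper n) (n + 1) := by
  ext1 i j
  simp only [todaMatrix, triMatrix, Matrix.add_apply, Matrix.of_apply, Matrix.scalar_apply,
    Matrix.diagonal_apply]
  by_cases hij : i = j
  · subst hij
    rw [todaDiag, dif_pos i.2]
    simp
  · have hij' : ¬ (i : ℕ) = j := fun h => hij (Fin.ext h)
    rw [if_neg hij, if_neg hij, if_neg hij', add_zero]
    split_ifs with h1 h2
    · rw [← h1, todaSuper, dif_pos (by omega)]
    · rfl
    · rfl

/-- The generating function of the Toda polynomials is a continuant. -/
theorem sum_pow_mul_coeff_det (n : ℕ) (x : ℂ) :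
    ∑ k ∈ Finset.range (n + 2), MvPolynomial.C (x ^ k) *
        ((todaMatrix n).map Polynomial.C +
          Matrix.scalar (Fin (n + 1)) (Polynomial.X : Polynomial _)).det.coeff k =
      continuant (todaDiag n x) (todaSuper n) (n + 1) := by
  rw [← det_triMatrix, ← todaMatrix_add_scalar]
  set D := ((todaMatrix n).map Polynomial.C +
    Matrix.scalar (Fin (n + 1)) (Polynomial.X : Polynomial _)).det with hD
  have hdeg : D.natDegree < n + 2 := by
    have h := Polynomial.natDegree_det_X_add_C_le (1 : Matrix (Fin (n + 1)) (Fin (n + 1)) _)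
      (todaMatrix n)
    have e : (Polynomial.X : Polynomial (MvPolynomial (Fin (n + 1) ⊕ Fin n) ℂ)) •
        (1 : Matrix (Fin (n + 1)) (Fin (n + 1)) _).map Polynomial.C +
        (todaMatrix n).map Polynomial.C = (todaMatrix n).map Polynomial.C +
        Matrix.scalar (Fin (n + 1)) Polynomial.X := by
      rw [add_comm (_ • _)]
      congr 1
      ext1 i j
      simp [Matrix.one_apply, Matrix.diagonal_apply]
    rw [e, ← hD, Fintype.card_fin] at h
    omega
  have heval : D.eval (MvPolynomial.C x) =
      (todaMatrix n + Matrix.scalar (Fin (n + 1)) (MvPolynomial.C x)).det := by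
    rw [hD, ← Polynomial.coe_evalRingHom, RingHom.map_det]
    congr 1
    ext1 i j
    simp [Matrix.diagonal_apply]
    split_ifs <;> simp
  rw [← heval, Polynomial.eval_eq_sum_range' hdeg]
  refine Finset.sum_congr rfl fun k _ => ?_
  rw [map_pow, mul_comm]

/-- The quantized continuant is the continuant of the Toda operators of the layer `i = 0`. -/
theorem quantOp_continuant (hlam : ∑ i, lam i = 0) (x : ℂ) :
    ∀ k ≤ n + 1, quantOp lam hbar (continuant (todaDiag n x) (todaSuper n) k) =
      layerOp lam hbar x 0 k := by
  have hdiag : ∀ P, ∀ j ≤ n, ∀ F, quantOp lam hbar (P * todaDiag n x j) F =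
      quantOp lam hbar P (x • F + hbar • edgeDer (vdir n 0 j) F + lowerPart lam 0 j * F) := by
    intro P j hj F
    rw [todaDiag, dif_pos (by omega), mul_add, map_add, quantOp_mul_X_inl, mul_comm P,
      ← MvPolynomial.smul_eq_C_mul, map_smul, LinearMap.add_apply, Module.End.mul_apply,
      twistedDer_vdir_zero lam hlam hbar hj, LinearMap.smul_apply, ← (quantOp lam hbar P).map_smul,
        ← map_add]
    congr 1
    ring
  intro k
  induction k using Nat.twoStepInduction with
  | zero =>
    intro _
    refine LinearMap.ext fun F => ?_
    rw [continuant_zero, quantOp_one, layerOp, opContinuant_zero, Module.End.one_apply]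
  | one =>
    intro _
    refine LinearMap.ext fun F => ?_
    rw [continuant_one, ← one_mul (todaDiag n x 0), hdiag _ _ (by omega), quantOp_one, layerOp,
      opContinuant_one, Module.End.one_apply]
  | more k ih1 ih2 =>
    intro hk
    refine LinearMap.ext fun F => ?_
    rw [continuant_add_two, map_add, LinearMap.add_apply, hdiag _ _ (by omega), ih2 (by omega),
      todaSuper, dif_pos (by omega), quantOp_X_inr_mul, ih1 (by omega)]
    simp only [layerOp, opContinuant_add_two, Module.End.mul_apply, LinearMap.mulLeft_apply]

/-- The generating function of the quantum Toda operators, applied to `1`, is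
`∏ (x - λ_i)` modulo exact terms and the box relations. -/
theorem sum_quantOp_sub_mem (hlam : ∑ i, lam i = 0) (x : ℂ)
    (N : Submodule ℂ (EdgeRing n)) (hbox : ∀ P ∈ boxIdeal n, P ∈ N)
    (hN : ∀ i j, i + 1 + j ≤ n → ∀ P, twistedDer lam hbar (vdir n (i + 1) j) P ∈ N) :
    (∑ k ∈ Finset.range (n + 2), x ^ k • quantOp lam hbar
      (((todaMatrix n).map Polynomial.C +
          Matrix.scalar (Fin (n + 1)) (Polynomial.X : Polynomial _)).det.coeff k) 1) -
      algebraMap ℂ _ (∏ i, (x - lam i)) ∈ N := by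
  have h := layerOp_sub_mem lam hlam hbar x N hbox hN (n + 1) 0 (by omega)
  rw [← quantOp_continuant lam hbar hlam x _ le_rfl, ← sum_pow_mul_coeff_det] at h
  convert h using 2
  · rw [map_sum, LinearMap.sum_apply]
    refine Finset.sum_congr rfl fun k _ => ?_
    rw [← MvPolynomial.smul_eq_C_mul, map_smul, LinearMap.smul_apply]
  · rw [← Finset.range_eq_Ico, Finset.prod_range]
    simp only [lamNat, Fin.is_lt, dif_pos, Fin.eta]

end Quantization

/-! ### Amplitudes: polynomials in the edge variables times the exponential of the phase -/

section Amplitude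

variable {n : ℕ}

/-- The value of a polynomial in the edge variables at the point `z` of the vertex space. -/
def evalEdge (z : VertexSpace n) : EdgeRing n →ₐ[ℂ] ℂ :=
  MvPolynomial.aeval fun e => Complex.exp (edgeLog z e)

/-- The function `P e ^ (f / ħ)` on the vertex space. -/
def amplitude (lam : Fin (n + 1) → ℂ) (hbar : ℂ) (P : EdgeRing n) (z : VertexSpace n) : ℂ :=
  evalEdge z P * Complex.exp (phase lam z.1 z.2 / hbar)

theorem volt_add (z w : VertexSpace n) (i j : ℕ) :
    volt (z + w).1 (z + w).2 i j = volt z.1 z.2 i j + volt w.1 w.2 i j := by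
  unfold volt
  split_ifs <;> simp

theorem volt_smul (c : ℂ) (z : VertexSpace n) (i j : ℕ) :
    volt (c • z).1 (c • z).2 i j = c * volt z.1 z.2 i j := by
  unfold volt
  split_ifs <;> simp

theorem edgeLog_add (z w : VertexSpace n) (e : Vtx n ⊕ Vtx n) :
    edgeLog (z + w) e = edgeLog z e + edgeLog w e := by
  rcases e with e | e <;>
    simp only [edgeLog, Sum.elim_inl, Sum.elim_inr, logU, logV, volt_add] <;> ring

theorem edgeLog_smul (c : ℂ) (z : VertexSpace n) (e : Vtx n ⊕ Vtx n) :
    edgeLog (c • z) e = c * edgeLog z e := by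
  rcases e with e | e <;>
    simp only [edgeLog, Sum.elim_inl, Sum.elim_inr, logU, logV, volt_smul] <;> ring

/-- `edgeLog` as a continuous linear functional. -/
def edgeLogCLM (e : Vtx n ⊕ Vtx n) : VertexSpace n →L[ℂ] ℂ :=
  LinearMap.toContinuousLinearMap
    { toFun := fun z => edgeLog z e
      map_add' := fun z w => edgeLog_add z w e
      map_smul' := fun c z => edgeLog_smul c z e }

theorem edgeLogCLM_apply (e : Vtx n ⊕ Vtx n) (z : VertexSpace n) :
    edgeLogCLM e z = edgeLog z e := rfl

theorem contDiff_edgeLog (e : Vtx n ⊕ Vtx n) : ContDiff ℂ 1 fun z : VertexSpace n => edgeLog z e :=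
  (edgeLogCLM e).contDiff

theorem fderiv_edgeLog (e : Vtx n ⊕ Vtx n) (z d : VertexSpace n) :
    fderiv ℂ (fun z : VertexSpace n => edgeLog z e) z d = edgeLog d e := by
  change fderiv ℂ (edgeLogCLM e) z d = _
  rw [ContinuousLinearMap.fderiv, edgeLogCLM_apply]

theorem evalEdge_X (z : VertexSpace n) (e : Vtx n ⊕ Vtx n) :
    evalEdge z (MvPolynomial.X e) = Complex.exp (edgeLog z e) :=
  MvPolynomial.aeval_X _ _

theorem evalEdge_C (z : VertexSpace n) (c : ℂ) : evalEdge z (MvPolynomial.C c) = c :=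
  MvPolynomial.aeval_C _ _

theorem contDiff_evalEdge (P : EdgeRing n) : ContDiff ℂ 1 fun z => evalEdge z P := by
  induction P using MvPolynomial.induction_on with
  | C c => simpa only [evalEdge_C] using contDiff_const
  | add P Q hP hQ => simpa only [map_add] using hP.add hQ
  | mul_X P e hP =>
    simpa only [map_mul, evalEdge_X] using hP.mul (contDiff_edgeLog e).cexp

theorem fderiv_evalEdge (P : EdgeRing n) (z d : VertexSpace n) :
    fderiv ℂ (fun z => evalEdge z P) z d = evalEdge z (edgeDer d P) := by
  induction P using MvPolynomial.induction_on with
  | C c =>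
    simp only [← MvPolynomial.algebraMap_eq,
      Derivation.map_algebraMap, map_zero]
    simp
  | add P Q hP hQ =>
    simp only [map_add]
    rw [fderiv_fun_add ((contDiff_evalEdge P).differentiable (by simp) z)
      ((contDiff_evalEdge Q).differentiable (by simp) z), add_apply, hP, hQ]
  | mul_X P e hP =>
    simp only [map_mul, evalEdge_X, Derivation.leibniz, map_add, smul_eq_mul, edgeDer_X, map_smul]
    have h1 := (contDiff_edgeLog (n := n) e).differentiable (by simp) z
    rw [fderiv_fun_mul ((contDiff_evalEdge P).differentiable (by simp) z) h1.cexp, add_apply,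
      smul_apply, smul_apply, hP, h1.hasFDerivAt.cexp.fderiv, smul_apply, fderiv_edgeLog]
    simp only [smul_eq_mul]
    ring

theorem linPart_eq_edgeLog (lam : Fin (n + 1) → ℂ) (z : VertexSpace n) : linPart lam z =
    ∑ e, (weightU lam e * edgeLog z (Sum.inl e) + weightV lam e * edgeLog z (Sum.inr e)) := rfl

theorem phase_eq (lam : Fin (n + 1) → ℂ) (z : VertexSpace n) :
    phase lam z.1 z.2 = evalEdge z (edgeSum n) + linPart lam z := by
  simp only [phase, edgeSum, map_sum, map_add, evalEdge_X]
  rfl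

theorem contDiff_linPart (lam : Fin (n + 1) → ℂ) :
    ContDiff ℂ 1 fun z : VertexSpace n => linPart lam z := by
  simp only [linPart_eq_edgeLog]
  exact ContDiff.sum fun e _ => (contDiff_const.mul (contDiff_edgeLog _)).add
    (contDiff_const.mul (contDiff_edgeLog _))

theorem fderiv_linPart (lam : Fin (n + 1) → ℂ) (z d : VertexSpace n) :
    fderiv ℂ (fun z : VertexSpace n => linPart lam z) z d = linPart lam d := by
  let L : VertexSpace n →L[ℂ] ℂ :=
    ∑ e, (weightU lam e • edgeLogCLM (Sum.inl e) + weightV lam e • edgeLogCLM (Sum.inr e))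
  have h : ∀ w, linPart lam w = L w := fun w => by
    simp [L, linPart_eq_edgeLog, edgeLogCLM_apply]
  simp only [h]
  rw [ContinuousLinearMap.fderiv]

theorem contDiff_amplitude (lam : Fin (n + 1) → ℂ) (hbar : ℂ) (P : EdgeRing n) :
    ContDiff ℂ 1 (amplitude lam hbar P) := by
  unfold amplitude
  simp only [phase_eq]
  exact (contDiff_evalEdge P).mul
    (((contDiff_evalEdge _).add (contDiff_linPart lam)).div_const hbar).cexp

/-- Differentiation of an amplitude is a twisted derivation of its polynomial factor. -/
theorem mul_fderiv_amplitude (lam : Fin (n + 1) → ℂ) {hbar : ℂ} (hh : hbar ≠ 0) (P : EdgeRing n)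
    (z d : VertexSpace n) : hbar * fderiv ℂ (amplitude lam hbar P) z d =
      amplitude lam hbar (twistedDer lam hbar d P) z := by
  unfold amplitude
  simp only [phase_eq]
  have h0 := (contDiff_evalEdge P).differentiable (by simp) z
  have h1 := (contDiff_evalEdge (edgeSum n)).differentiable (by simp) z
  have h2 := (contDiff_linPart lam).differentiable (by simp) z
  have h3 : DifferentiableAt ℂ
    (fun z : VertexSpace n => (evalEdge z (edgeSum n) + linPart lam z) / hbar) z :=
    by simpa only [div_eq_mul_inv] using (h1.fun_add h2).mul_const hbar⁻¹
  rw [fderiv_fun_mul h0 h3.cexp, add_apply, smul_apply, smul_apply, fderiv_evalEdge,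
    h3.hasFDerivAt.cexp.fderiv, smul_apply]
  simp only [div_eq_mul_inv]
  rw [fderiv_mul_const (h1.fun_add h2), smul_apply, fderiv_fun_add h1 h2, add_apply,
    fderiv_evalEdge,
    fderiv_linPart, twistedDer_apply, map_add, map_mul, map_add, evalEdge_C, map_smul]
  simp only [smul_eq_mul]
  field_simp
  ring

theorem one_le_edgeSize (z : VertexSpace n) : 1 ≤ edgeSize z.1 z.2 := by
  unfold edgeSize
  have : 0 ≤ ∑ e, (‖edgeU z.1 z.2 e‖ + ‖edgeV z.1 z.2 e‖) :=
    Finset.sum_nonneg fun e _ => by positivity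
  linarith

theorem norm_exp_edgeLog_le (z : VertexSpace n) (e : Vtx n ⊕ Vtx n) :
    ‖Complex.exp (edgeLog z e)‖ ≤ edgeSize z.1 z.2 := by
  have h : ∀ a, ‖edgeU z.1 z.2 a‖ + ‖edgeV z.1 z.2 a‖ ≤ edgeSize z.1 z.2 := by
    intro a
    have := Finset.single_le_sum (f := fun e => ‖edgeU z.1 z.2 e‖ + ‖edgeV z.1 z.2 e‖)
      (fun e _ => by positivity) (Finset.mem_univ a)
    unfold edgeSize
    linarith
  rcases e with a | a
  · exact (le_add_of_nonneg_right (norm_nonneg _)).trans (h a)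
  · exact (le_add_of_nonneg_left (norm_nonneg _)).trans (h a)

/-- Polynomials in the edge variables grow at most like a power of `edgeSize`. -/
theorem exists_norm_evalEdge_le (P : EdgeRing n) :
    ∃ (c : ℝ) (k : ℕ), 0 ≤ c ∧ ∀ z, ‖evalEdge z P‖ ≤ c * edgeSize z.1 z.2 ^ k := by
  induction P using MvPolynomial.induction_on with
  | C a => exact ⟨‖a‖, 0, norm_nonneg a, fun z => by simp⟩
  | add P Q hP hQ =>
    obtain ⟨c, k, hc, h⟩ := hP
    obtain ⟨c', k', hc', h'⟩ := hQ
    refine ⟨c + c', max k k', by positivity, fun z => ?_⟩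
    rw [map_add, add_mul]
    refine (norm_add_le _ _).trans (add_le_add ((h z).trans ?_) ((h' z).trans ?_))
    · gcongr
      exacts [one_le_edgeSize z, le_max_left _ _]
    · gcongr
      exacts [one_le_edgeSize z, le_max_right _ _]
  | mul_X P e hP =>
    obtain ⟨c, k, hc, h⟩ := hP
    refine ⟨c, k + 1, hc, fun z => ?_⟩
    rw [map_mul, evalEdge_X, norm_mul, pow_succ, ← mul_assoc]
    exact mul_le_mul (h z) (norm_exp_edgeLog_le z e) (norm_nonneg _)
      (mul_nonneg hc (pow_nonneg (zero_le_one.trans (one_le_edgeSize z)) _))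

theorem vdir_zero (j : Fin (n + 1)) : vdir n 0 j = (Pi.single j 1, 0) := by
  unfold vdir
  congr 1
  · funext k
    simp [Pi.single_apply, Fin.ext_iff]
  · funext e
    have := e.2.1
    rw [if_neg (by omega)]
    rfl

theorem vdir_succ (i j : ℕ) (h : 1 ≤ i + 1 ∧ i + 1 + j ≤ n) :
    vdir n (i + 1) j = (0, Pi.single (vtx (i + 1) j h) 1) := by
  refine Prod.ext ?_ ?_
  · funext k
    change (if i + 1 = 0 ∧ (k : ℕ) = j then (1 : ℂ) else 0) = 0
    rw [if_neg (by omega)]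
  · funext e
    simp [vdir, Pi.single_apply, vtx, Subtype.ext_iff, Prod.ext_iff, Fin.ext_iff]

theorem evalEdge_eu (z : VertexSpace n) {i j : ℕ} (h : 1 ≤ i + 1 ∧ i + 1 + j ≤ n) :
    evalEdge z (eu n (i + 1) j) =
      Complex.exp (volt z.1 z.2 (i + 1) j - volt z.1 z.2 i j) := by
  rw [eu, dif_pos h, evalEdge_X]
  rfl

theorem evalEdge_ev (z : VertexSpace n) {i j : ℕ} (h : 1 ≤ i + 1 ∧ i + 1 + j ≤ n) :
    evalEdge z (ev n (i + 1) j) =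
      Complex.exp (volt z.1 z.2 i (j + 1) - volt z.1 z.2 (i + 1) j) := by
  rw [ev, dif_pos h, evalEdge_X]
  rfl

theorem evalEdge_eq_zero_of_mem_boxIdeal (z : VertexSpace n) {P : EdgeRing n}
    (hP : P ∈ boxIdeal n) : evalEdge z P = 0 := by
  have h : boxIdeal n ≤ RingHom.ker (evalEdge z) := by
    refine Ideal.span_le.2 ?_
    rintro _ ⟨i, j, hi, hij, rfl⟩
    obtain ⟨k, rfl⟩ : ∃ k, i = k + 1 := ⟨i - 1, by omega⟩
    rw [SetLike.mem_coe, RingHom.mem_ker, map_sub, map_mul, map_mul, evalEdge_ev z (by omega),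
      evalEdge_eu z (by omega), evalEdge_eu z (by omega), evalEdge_ev z (by omega),
      ← Complex.exp_add, ← Complex.exp_add, sub_eq_zero]
    congr 1
    ring
  exact h hP

theorem evalEdge_roof (z : VertexSpace n) (k : Fin n) :
    evalEdge z (roof n 0 ((k : ℕ) + 1)) = qVar z.1 k := by
  rw [roof, map_mul, evalEdge_eu z (by omega), evalEdge_ev z (by omega), ← Complex.exp_add, qVar]
  congr 1
  have v0 : ∀ (l : ℕ) (h : l < n + 1), volt z.1 z.2 0 l = z.1 ⟨l, h⟩ := by
    intro l h
    simp [volt, h]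
  rw [v0 k (by omega), v0 (k + 1) (by omega)]
  simp only [Fin.succ, Fin.castSucc, Fin.castAdd, Fin.castLE]
  ring

end Amplitude

/-! ### The oscillating integral as a linear functional of the amplitude -/

section Functional

open MeasureTheory Filter

variable {n : ℕ} {lam : Fin (n + 1) → ℂ} {hbar : ℂ} {U : Set (Fin (n + 1) → ℂ)}
  {Φ : (Fin (n + 1) → ℂ) → (Vtx n → ℝ) → Vtx n → ℂ}

/-- The Jacobian matrix in `density` is the transpose of `jacRows`. -/
theorem density_eq (t : Fin (n + 1) → ℂ) (x : Vtx n → ℝ) : density lam hbar t (Φ t) x =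
    amplitude lam hbar 1 (t, Φ t x) * rowDet (Vtx n) (jacRows (Φ t) x) := by
  rw [density, amplitude, map_one, one_mul, rowDet_apply, ← Matrix.det_transpose]
  rfl

theorem oscIntegral_eq (t : Fin (n + 1) → ℂ) : oscIntegral lam hbar t (Φ t) =
    cellIntegral (amplitude lam hbar 1) Φ t := by
  simp only [oscIntegral, cellIntegral, density_eq]

/-- Along a flat family every amplitude is dominated by an integrable function, locally uniformly
in the parameter. -/
theorem IsFlatFamily.exists_bound (hΦ : IsFlatFamily lam hbar U Φ) {t₁ : Fin (n + 1) → ℂ}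
    (ht₁ : t₁ ∈ U) (P : EdgeRing n) : ∃ G : (Vtx n → ℝ) → ℝ, Integrable G ∧
      ∀ᶠ t in 𝓝 t₁, ∀ x, ‖amplitude lam hbar P (t, Φ t x)‖ *
        (1 + ‖fderiv ℝ (Function.uncurry Φ) (t, x)‖) ^ Fintype.card (Vtx n) ≤ G x := by
  obtain ⟨c, k, hc, hP⟩ := exists_norm_evalEdge_le P
  obtain ⟨G, hG, h⟩ := hΦ.convergent t₁ ht₁ k
  refine ⟨fun x => c * G x, hG.const_mul c, ?_⟩
  filter_upwards [h] with t ht x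
  rw [amplitude, norm_mul, Complex.norm_exp]
  calc _ ≤ c * edgeSize t (Φ t x) ^ k * Real.exp (phase lam t (Φ t x) / hbar).re *
        (1 + ‖fderiv ℝ (Function.uncurry Φ) (t, x)‖) ^ Fintype.card (Vtx n) := by
        gcongr
        exact hP (t, Φ t x)
    _ = c * (Real.exp (phase lam t (Φ t x) / hbar).re * edgeSize t (Φ t x) ^ k *
        (1 + ‖fderiv ℝ (Function.uncurry Φ) (t, x)‖) ^ Fintype.card (Vtx n)) := by ring
    _ ≤ c * G x := mul_le_mul_of_nonneg_left (ht x) hc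

theorem IsFlatFamily.integrable (hΦ : IsFlatFamily lam hbar U Φ) (hU : IsOpen U)
    {t : Fin (n + 1) → ℂ} (ht : t ∈ U) (P : EdgeRing n) :
    Integrable fun x => amplitude lam hbar P (t, Φ t x) *
      rowDet (Vtx n) (jacRows (Φ t) x) := by
  obtain ⟨G, hG, h⟩ := hΦ.exists_bound ht P
  have hs := contDiff_slice hU hΦ.smooth ht
  refine (hG.const_mul ‖rowDet (Vtx n)‖).mono' ?_ (Eventually.of_forall fun x => ?_)
  · exact (((contDiff_amplitude lam hbar P).continuous.comp
      (continuous_const.prodMk hs.continuous)).mul ((rowDet (Vtx n)).cont.comp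
        (contDiff_jacRows (hs.of_le (WithTop.coe_le_coe.2 le_top))).continuous)).aestronglyMeasurable
  · rw [norm_mul]
    calc _ ≤ ‖amplitude lam hbar P (t, Φ t x)‖ * (‖rowDet (Vtx n)‖ *
          (1 + ‖fderiv ℝ (Function.uncurry Φ) (t, x)‖) ^ Fintype.card (Vtx n)) := by
          gcongr
          refine norm_rowDet_le fun b => ((fderiv ℝ (Φ t) x).le_opNorm _).trans ?_
          rw [Pi.norm_single, norm_one, mul_one]
          linarith [norm_fderiv_slice_le hU hΦ.smooth ht x]
      _ = ‖rowDet (Vtx n)‖ * (‖amplitude lam hbar P (t, Φ t x)‖ *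
          (1 + ‖fderiv ℝ (Function.uncurry Φ) (t, x)‖) ^ Fintype.card (Vtx n)) := by ring
      _ ≤ _ := mul_le_mul_of_nonneg_left (h.self_of_nhds x) (norm_nonneg _)

/-- The integral over the cell `Φ t` as a linear functional of the polynomial amplitude. -/
def cellFunctional (hΦ : IsFlatFamily lam hbar U Φ) (hU : IsOpen U)
    {t : Fin (n + 1) → ℂ} (ht : t ∈ U) : EdgeRing n →ₗ[ℂ] ℂ where
  toFun P := cellIntegral (amplitude lam hbar P) Φ t
  map_add' P Q := by
    rw [cellIntegral, cellIntegral, cellIntegral,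
      ← integral_add (hΦ.integrable hU ht P) (hΦ.integrable hU ht Q)]
    congr 1
    funext x
    simp only [amplitude, map_add]
    ring
  map_smul' c P := by
    rw [cellIntegral, cellIntegral, RingHom.id_apply, smul_eq_mul, ← integral_const_mul]
    congr 1
    funext x
    simp only [amplitude, map_smul, smul_eq_mul]
    ring

/-- Integrals of amplitudes over a flat family are holomorphic in the parameter. -/
theorem IsFlatFamily.hasFDerivAt (hΦ : IsFlatFamily lam hbar U Φ) (hU : IsOpen U)
    (hh : hbar ≠ 0) {t : Fin (n + 1) → ℂ} (ht : t ∈ U) (P : EdgeRing n) :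
    HasFDerivAt (cellIntegral (amplitude lam hbar P) Φ)
      (∑ j, cellIntegral (fun p => fderiv ℂ (amplitude lam hbar P) p (Pi.single j 1, 0)) Φ t •
        ContinuousLinearMap.proj (R := ℂ) (φ := fun _ : Fin (n + 1) => ℂ) j) t := by
  obtain ⟨G, hG, hb⟩ := hΦ.exists_bound ht P
  choose G' hG' hb' using fun j : Fin (n + 1) =>
    hΦ.exists_bound ht (twistedDer lam hbar (vdir n 0 j) P)
  have hnn : ∀ᶠ s in 𝓝 t, ∀ x j, 0 ≤ G' j x := by
    filter_upwards [eventually_all.2 hb'] with s hs x j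
    exact le_trans (by positivity) (hs j x)
  refine hasFDerivAt_cellIntegral hU hΦ.smooth (contDiff_amplitude lam hbar P) ht
    (G := fun x => G x + ‖hbar‖⁻¹ * ∑ j, G' j x)
    (hG.add ((integrable_finsetSum _ fun j _ => hG' j).const_mul _)) ?_ ?_
  · filter_upwards [hb, hnn] with s hs hs' x
    exact (hs x).trans (le_add_of_nonneg_right
      (mul_nonneg (by positivity) (Finset.sum_nonneg fun j _ => hs' x j)))
  · filter_upwards [hb, eventually_all.2 hb'] with s hs hs' x v
    have hv : ((v, 0) : VertexSpace n) = ∑ j : Fin (n + 1), v j • vdir n 0 j := by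
      simp only [vdir_zero]
      ext i
      · simp [Prod.fst_sum, Finset.sum_apply, Pi.single_apply]
      · simp [Prod.snd_sum]
    have hd : ∀ j : Fin (n + 1), fderiv ℂ (amplitude lam hbar P) (s, Φ s x) (vdir n 0 j) =
        hbar⁻¹ * amplitude lam hbar (twistedDer lam hbar (vdir n 0 j) P) (s, Φ s x) := by
      intro j
      rw [← mul_fderiv_amplitude lam hh, inv_mul_cancel_left₀ hh]
    set M := (1 + ‖fderiv ℝ (Function.uncurry Φ) (s, x)‖) ^ Fintype.card (Vtx n) with hM
    have hM0 : 0 ≤ M := by positivity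
    have hG0 : 0 ≤ G x := le_trans (by positivity) (hs x)
    rw [hv, map_sum]
    simp only [map_smul, hd, smul_eq_mul]
    calc _ ≤ (∑ j : Fin (n + 1), ‖v‖ * (‖hbar‖⁻¹ *
          ‖amplitude lam hbar (twistedDer lam hbar (vdir n 0 j) P) (s, Φ s x)‖)) * M := by
          gcongr
          refine (norm_sum_le _ _).trans (Finset.sum_le_sum fun j _ => ?_)
          rw [norm_mul, norm_mul, norm_inv]
          gcongr
          exact norm_le_pi_norm v j
      _ = ‖v‖ * (‖hbar‖⁻¹ * ∑ j : Fin (n + 1),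
          ‖amplitude lam hbar (twistedDer lam hbar (vdir n 0 j) P) (s, Φ s x)‖ * M) := by
          rw [Finset.sum_mul, Finset.mul_sum, Finset.mul_sum]
          refine Finset.sum_congr rfl fun j _ => ?_
          ring
      _ ≤ ‖v‖ * (‖hbar‖⁻¹ * ∑ j, G' j x) := by
          gcongr with j
          exact hs' j x
      _ ≤ _ := by
          gcongr
          exact le_add_of_nonneg_left hG0

/-- `ħ ∂ / ∂t_j` acts on the integral as the twisted derivation `∇_j` on the amplitude. -/
theorem IsFlatFamily.hPartial_cellIntegral (hΦ : IsFlatFamily lam hbar U Φ) (hU : IsOpen U)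
    (hh : hbar ≠ 0) {t : Fin (n + 1) → ℂ} (ht : t ∈ U) (P : EdgeRing n) (j : Fin (n + 1)) :
    hPartial hbar j (cellIntegral (amplitude lam hbar P) Φ) t =
      cellIntegral (amplitude lam hbar (twistedDer lam hbar (vdir n 0 j) P)) Φ t := by
  rw [hPartial, (hΦ.hasFDerivAt hU hh ht P).fderiv]
  simp only [sum_apply, smul_apply, ContinuousLinearMap.proj_apply,
    Pi.single_apply, smul_eq_mul, mul_ite, mul_one, mul_zero]
  rw [Finset.sum_ite_eq' Finset.univ j, if_pos (Finset.mem_univ j), cellIntegral, cellIntegral,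
    ← integral_const_mul]
  congr 1
  funext x
  rw [← mul_fderiv_amplitude lam hh, vdir_zero, mul_assoc]

theorem hPartial_congr (hU : IsOpen U) {F G : (Fin (n + 1) → ℂ) → ℂ} (h : Set.EqOn F G U)
    (j : Fin (n + 1)) : Set.EqOn (hPartial hbar j F) (hPartial hbar j G) U := by
  intro t ht
  rw [hPartial, hPartial, (h.eventuallyEq_of_mem (hU.mem_nhds ht)).fderiv_eq]

/-- Iterated derivatives act on the integral through iterated twisted derivations. The family is
only given over `U`, and derivatives at points of the open set `U` only depend on values there. -/
theorem IsFlatFamily.hPartials_cellIntegral (hΦ : IsFlatFamily lam hbar U Φ) (hU : IsOpen U)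
    (hh : hbar ≠ 0) (a : Fin (n + 1) → ℕ) (P : EdgeRing n) {t : Fin (n + 1) → ℂ} (ht : t ∈ U) :
    hPartials hbar a (cellIntegral (amplitude lam hbar P) Φ) t =
      cellIntegral (amplitude lam hbar (twistedMonomial lam hbar a P)) Φ t := by
  have hiter : ∀ (j : Fin (n + 1)) (k : ℕ) (F : (Fin (n + 1) → ℂ) → ℂ) (Q : EdgeRing n),
      Set.EqOn F (cellIntegral (amplitude lam hbar Q) Φ) U →
      Set.EqOn ((hPartial hbar j)^[k] F) (cellIntegral (amplitude lam hbar
        ((twistedDer lam hbar (vdir n 0 j) ^ k) Q)) Φ) U := by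
    intro j k
    induction k with
    | zero => intro F Q h; simpa using h
    | succ k ih =>
      intro F Q h s hs
      rw [Function.iterate_succ_apply', hPartial_congr hU (ih F Q h) j hs,
        hΦ.hPartial_cellIntegral hU hh hs, pow_succ', Module.End.mul_apply]
  have hlist : ∀ l : List (Fin (n + 1)), Set.EqOn
      (l.foldr (fun j G => (hPartial hbar j)^[a j] G) (cellIntegral (amplitude lam hbar P) Φ))
      (cellIntegral (amplitude lam hbar ((l.map fun j : Fin (n + 1) =>
        twistedDer lam hbar (vdir n 0 j) ^ a j).prod P)) Φ) U := by
    intro l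
    induction l with
    | nil => intro s _; simp
    | cons j l ih =>
      rw [List.foldr_cons, List.map_cons, List.prod_cons]
      exact hiter j (a j) _ _ ih
  exact hlist _ ht

/-- The quantized operator of a polynomial acts on the integral through its amplitude. -/
theorem IsFlatFamily.quantize_cellIntegral (hΦ : IsFlatFamily lam hbar U Φ) (hU : IsOpen U)
    (hh : hbar ≠ 0) {t : Fin (n + 1) → ℂ} (ht : t ∈ U)
    (P : MvPolynomial (Fin (n + 1) ⊕ Fin n) ℂ) (A : EdgeRing n) :
    quantize hbar P (cellIntegral (amplitude lam hbar A) Φ) t =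
      cellFunctional hΦ hU ht (quantOp lam hbar P A) := by
  have hP : quantOp lam hbar P = ∑ m ∈ P.support, P.coeff m • monomialOp lam hbar m := by
    conv_lhs => rw [P.as_sum]
    rw [map_sum]
    exact Finset.sum_congr rfl fun m _ => quantOp_monomial lam hbar m _
  rw [hP, LinearMap.sum_apply, map_sum, quantize]
  refine Finset.sum_congr rfl fun m _ => ?_
  rw [hΦ.hPartials_cellIntegral hU hh _ _ ht, LinearMap.smul_apply, map_smul, smul_eq_mul,
    mul_assoc]
  congr 1
  rw [monomialOp, Module.End.mul_apply, LinearMap.mulLeft_apply]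
  change _ = cellIntegral _ Φ t
  rw [cellIntegral, cellIntegral, ← integral_const_mul]
  congr 1
  funext x
  simp only [amplitude, map_mul, map_prod, map_pow, evalEdge_roof]
  ring

theorem cellFunctional_eq_zero_of_mem_boxIdeal (hΦ : IsFlatFamily lam hbar U Φ) (hU : IsOpen U)
    {t : Fin (n + 1) → ℂ} (ht : t ∈ U) {P : EdgeRing n} (hP : P ∈ boxIdeal n) :
    cellFunctional hΦ hU ht P = 0 := by
  change cellIntegral _ Φ t = 0
  simp [cellIntegral, amplitude, evalEdge_eq_zero_of_mem_boxIdeal _ hP]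

/-- The integral of an exact form vanishes. -/
theorem cellFunctional_twistedDer (hΦ : IsFlatFamily lam hbar U Φ) (hU : IsOpen U)
    (hh : hbar ≠ 0) {t : Fin (n + 1) → ℂ} (ht : t ∈ U) {i j : ℕ} (hij : i + 1 + j ≤ n)
    (P : EdgeRing n) :
    cellFunctional hΦ hU ht (twistedDer lam hbar (vdir n (i + 1) j) P) = 0 := by
  obtain ⟨G, hG, hb⟩ := hΦ.exists_bound ht P
  obtain ⟨G', hG', hb'⟩ := hΦ.exists_bound ht (twistedDer lam hbar (vdir n (i + 1) j) P)
  set a : Vtx n := vtx (i + 1) j (by omega) with ha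
  have hvd : vdir n (i + 1) j = (0, Pi.single a 1) := vdir_succ i j (by omega)
  have hs := contDiff_slice hU hΦ.smooth ht
  have hslice : ∀ y, fderiv ℂ (fun y => amplitude lam hbar P (t, y)) y (Pi.single a 1) =
      hbar⁻¹ * amplitude lam hbar (twistedDer lam hbar (vdir n (i + 1) j) P) (t, y) := by
    intro y
    have h := ((contDiff_amplitude lam hbar P).differentiable (by simp) (t, y)).hasFDerivAt.comp y
      (hasFDerivAt_prodMk_right t y)
    have h' : HasFDerivAt (fun y => amplitude lam hbar P (t, y)) _ y := h
    rw [h'.fderiv, ← mul_fderiv_amplitude lam hh, inv_mul_cancel_left₀ hh, hvd]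
    simp
  have hpow : ∀ x, (1 + ‖fderiv ℝ (Φ t) x‖) ^ Fintype.card (Vtx n) ≤
      (1 + ‖fderiv ℝ (Function.uncurry Φ) (t, x)‖) ^ Fintype.card (Vtx n) := fun x => by
    gcongr
    exact norm_fderiv_slice_le hU hΦ.smooth ht x
  have hb0 := hb.self_of_nhds
  have hb1 := hb'.self_of_nhds
  have key := integral_fderiv_mul_rowDet_eq_zero (φ := Φ t)
    (g := fun y => amplitude lam hbar P (t, y)) (hs.of_le (WithTop.coe_le_coe.2 le_top))
    ((contDiff_amplitude lam hbar P).comp (contDiff_const.prodMk contDiff_id)) a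
    (G := fun x => G x + ‖hbar‖⁻¹ * G' x) (hG.add (hG'.const_mul _)) (fun x => ?_) fun x => ?_
  · simp only [hslice, mul_assoc] at key
    rw [integral_const_mul] at key
    exact (mul_eq_zero.1 key).resolve_left (inv_ne_zero hh)
  · have h1 : 0 ≤ G' x := le_trans (by positivity) (hb1 x)
    calc _ ≤ G x := (mul_le_mul_of_nonneg_left (hpow x) (norm_nonneg _)).trans (hb0 x)
      _ ≤ _ := le_add_of_nonneg_right (by positivity)
  · have h1 : 0 ≤ G x := le_trans (by positivity) (hb0 x)
    rw [hslice, norm_mul, norm_inv, mul_assoc]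
    calc _ ≤ ‖hbar‖⁻¹ * G' x := mul_le_mul_of_nonneg_left
          ((mul_le_mul_of_nonneg_left (hpow x) (norm_nonneg _)).trans (hb1 x)) (by positivity)
      _ ≤ _ := le_add_of_nonneg_left h1

/-- The generating function of the eigenvalue equations. -/
theorem IsFlatFamily.sum_pow_mul_quantize (hΦ : IsFlatFamily lam hbar U Φ) (hU : IsOpen U)
    (hh : hbar ≠ 0) (hlam : ∑ i, lam i = 0) {t : Fin (n + 1) → ℂ} (ht : t ∈ U) (x : ℂ) :
    ∑ k ∈ Finset.range (n + 2), x ^ k *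
        quantize hbar (((todaMatrix n).map Polynomial.C +
          Matrix.scalar (Fin (n + 1)) (Polynomial.X : Polynomial _)).det.coeff k)
          (cellIntegral (amplitude lam hbar 1) Φ) t =
      (∏ i, (x - lam i)) * cellIntegral (amplitude lam hbar 1) Φ t := by
  have h := sum_quantOp_sub_mem lam hbar hlam x (LinearMap.ker (cellFunctional hΦ hU ht))
    (fun P hP => cellFunctional_eq_zero_of_mem_boxIdeal hΦ hU ht hP)
    (fun i j hij P => cellFunctional_twistedDer hΦ hU hh ht hij P)
  rw [LinearMap.mem_ker, map_sub, sub_eq_zero, map_sum, Algebra.algebraMap_eq_smul_one,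
    map_smul] at h
  simp only [hΦ.quantize_cellIntegral hU hh ht]
  simp only [map_smul, smul_eq_mul] at h
  exact h

end Functional

end TodaMirror

end

theorem mainTheorem1 (n : ℕ) (lam : Fin (n + 1) → ℂ) (hlam : ∑ i, lam i = 0)
    (hbar : ℂ) (hhbar : hbar ≠ 0)
    (U : Set (Fin (n + 1) → ℂ)) (hU : IsOpen U) (t₀ : Fin (n + 1) → ℂ) (ht₀ : t₀ ∈ U)
    (c : Vtx n → ℂ) (hc : IsNondegenerateCriticalPoint (phase lam t₀) c)
    (Φ : (Fin (n + 1) → ℂ) → (Vtx n → ℝ) → Vtx n → ℂ)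
    (hΓ : IsDescendingMorseCycle (phase lam t₀) c (Φ t₀))
    (hΦ : IsFlatFamily lam hbar U Φ) :
    (∀ t ∈ U, MeasureTheory.Integrable (density lam hbar t (Φ t))) ∧
    DifferentiableOn ℂ (fun t => oscIntegral lam hbar t (Φ t)) U ∧
    ∀ i ∈ Finset.Icc 1 (n + 1), ∀ t ∈ U,
      quantumToda hbar i (fun s => oscIntegral lam hbar s (Φ s)) t =
        sigma lam i * oscIntegral lam hbar t (Φ t) := by
  have hI : (fun t => oscIntegral lam hbar t (Φ t)) =
      cellIntegral (amplitude lam hbar 1) Φ := funext fun t => oscIntegral_eq t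
  refine ⟨fun t ht => ?_, fun t ht => ?_, fun i hi t ht => ?_⟩
  · have h : density lam hbar t (Φ t) = fun x => amplitude lam hbar 1 (t, Φ t x) *
        rowDet (Vtx n) (jacRows (Φ t) x) := funext fun x => density_eq t x
    rw [h]
    exact hΦ.integrable hU ht 1
  · rw [hI]
    exact (hΦ.hasFDerivAt hU hhbar ht 1).differentiableAt.differentiableWithinAt
  · rw [hI, oscIntegral_eq, quantumToda, todaPoly, sigma]
    set I := cellIntegral (amplitude lam hbar 1) Φ with hIdef
    set D := ((todaMatrix n).map Polynomial.C +
      Matrix.scalar (Fin (n + 1)) (Polynomial.X : Polynomial _)).det with hD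
    -- both sides are the coefficients of polynomials in `x` that agree for all `x`
    have hpoly : ∑ k ∈ Finset.range (n + 2),
        Polynomial.C (quantize hbar (D.coeff k) I t) * Polynomial.X ^ k =
        (∏ j, (Polynomial.X - Polynomial.C (lam j))) * Polynomial.C (I t) := by
      refine Polynomial.funext fun x => ?_
      have h := hΦ.sum_pow_mul_quantize hU hhbar hlam ht x
      simp only [Polynomial.eval_finsetSum, Polynomial.eval_mul, Polynomial.eval_C,
        Polynomial.eval_pow, Polynomial.eval_X, Polynomial.eval_prod, Polynomial.eval_sub]
      rw [← h]
      exact Finset.sum_congr rfl fun k _ => mul_comm _ _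
    have hcoeff := congrArg (fun p => Polynomial.coeff p (n + 1 - i)) hpoly
    simp only [Polynomial.finsetSum_coeff, Polynomial.coeff_C_mul, Polynomial.coeff_X_pow,
      Polynomial.coeff_mul_C, mul_ite, mul_one, mul_zero] at hcoeff
    rw [Finset.sum_ite_eq, if_pos (by rw [Finset.mem_range]; omega)] at hcoeff
    exact hcoeff
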